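/- An $m$-message protocol in the (parallel) shuffle model for $n$ users consists of a local randomizer $R:[0,1]\to Y^m$ and an analyzer $A:(Y^n)^m\to\mathbb{R}$, both randomized maps. On inputs $x=(x_1,\dots,x_n)\in[0,1]^n$ each user $i$ independently samples messages $(y_i^{(1)},\dots,y_i^{(m)})=R(x_i)$; for each $j$ the tuple $(y_1^{(j)},\dots,y_n^{(j)})$ is permuted by a uniformly random permutation, independently over $j$ and of the messages. The $m$ permuted tuples form the view $V(x)$, and the output is $M(x)=A(V(x))$. The protocol is $(\varepsilon,\delta)$-DP if $\Pr[V(x)\in E]-e^{\varepsilon}\Pr[V(x')\in E]\le\delta$ for all $x,x'\in[0,1]^n$ differing in at most one coordinate and all measurable events $E$. Its mean squared error is $\mathrm{MSE}=\sup_{x\in[0,1]^n}\mathbb{E}\big[(M(x)-\sum_{i=1}^n x_i)^2\big]$. **Theorem.** For every $\varepsilon_0>0$ there is a constant $C>0$, and for every $\delta_0\in(0,1)$ a constant $K>0$ (depending only on $\varepsilon_0$ and $\delta_0$), such that for all $0<\varepsilon\le\varepsilon_0$, all $0<\delta\le\delta_0$ and all integers $n\ge 2$ there is an $(\varepsilon,\delta)$-DP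 protocol for $n$ users in the shuffle model, with some number $m\geq 1$ of messages per user and message space $Y=\{0,1\}^b$, such that $$\mathrm{MSE}\le \frac{C}{\varepsilon^2},\qquad m\le K\log(1/\delta),\qquad b\le C\log n .$$ -/

import Mathlib

open MeasureTheory ProbabilityTheory
open scoped ENNReal

noncomputable section

namespace ShuffleModel

/-- An `m`-message protocol for `n` users in the (parallel) shuffle model: a local randomizer,
used by every user, that turns an input in `X` into `m` random messages in `Y`, and a (possibly
randomized) analyzer that maps the outputs of the `m` shufflers to an output in `O`. -/
structure Protocol (X Y O : Type*) [MeasurableSpace X] [MeasurableSpace Y] [MeasurableSpace O]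
    (n m : ℕ) where
  randomizer : Kernel X (Fin m → Y)
  analyzer : Kernel (Fin m → Fin n → Y) O
  markov_randomizer : IsMarkovKernel randomizer
  markov_analyzer : IsMarkovKernel analyzer

/-- The effect of `m` shufflers: the `j`-th messages of all users (`y i j` is the `j`-th message
of user `i`) are rearranged by the permutation `π j`. -/
def shuffle {Y : Type*} {n m : ℕ} (π : Fin m → Equiv.Perm (Fin n)) (y : Fin n → Fin m → Y) :
    Fin m → Fin n → Y :=
  fun j i => y (π j i) j

theorem measurable_shuffle {Y : Type*} [MeasurableSpace Y] {n m : ℕ}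
    (π : Fin m → Equiv.Perm (Fin n)) :
    Measurable (shuffle π : (Fin n → Fin m → Y) → Fin m → Fin n → Y) := by
  unfold shuffle
  fun_prop

namespace Protocol

variable {X Y O : Type*} [MeasurableSpace X] [MeasurableSpace Y] [MeasurableSpace O] {n m : ℕ}

/-- The joint law of all messages before shuffling: the users randomize independently. -/
def messages (P : Protocol X Y O n m) (x : Fin n → X) : Measure (Fin n → Fin m → Y) :=
  Measure.pi fun i => P.randomizer (x i)

/-- The law of the data collector's view: the messages are sent through `m` shufflers, which use
independent uniformly random permutations, i.e. a uniformly random `m`-tuple `π` of permutations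
that is independent of the messages. -/
def view (P : Protocol X Y O n m) (x : Fin n → X) : Measure (Fin m → Fin n → Y) :=
  (Fintype.card (Fin m → Equiv.Perm (Fin n)) : ℝ≥0∞)⁻¹ •
    ∑ π : Fin m → Equiv.Perm (Fin n), (P.messages x).map (shuffle π)

/-- The law of the output of the protocol: the analyzer is applied to the view. -/
def mechanism (P : Protocol X Y O n m) (x : Fin n → X) : Measure O :=
  (P.view x).bind P.analyzer

/-- `(ε, δ)`-differential privacy of a protocol, formulated for the data collector's view. -/
def IsDP (P : Protocol X Y O n m) (ε δ : ℝ) : Prop :=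
  ∀ x x' : Fin n → X, (∃ i, ∀ j, j ≠ i → x j = x' j) →
    ∀ E : Set (Fin m → Fin n → Y), MeasurableSet E →
      (P.view x).real E - Real.exp ε * (P.view x').real E ≤ δ

/-- The worst-case mean squared error of a protocol for the summation of reals in `[0, 1]`. -/
def MSE (P : Protocol (Set.Icc (0 : ℝ) 1) Y ℝ n m) : ℝ≥0∞ :=
  ⨆ x : Fin n → Set.Icc (0 : ℝ) 1,
    ∫⁻ z, ENNReal.ofReal ((z - ∑ i, (x i : ℝ)) ^ 2) ∂(P.mechanism x)

theorem isProbabilityMeasure_view (P : Protocol X Y O n m) (x : Fin n → X) :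
    IsProbabilityMeasure (P.view x) := by
  have := P.markov_randomizer
  have h : IsProbabilityMeasure (P.messages x) := by
    unfold messages
    infer_instance
  constructor
  have h1 : ∀ π : Fin m → Equiv.Perm (Fin n),
      (P.messages x).map (shuffle π) Set.univ = 1 := fun π => by
    rw [Measure.map_apply (measurable_shuffle π) MeasurableSet.univ]
    simp
  simp only [view, Measure.smul_apply, Measure.finsetSum_apply, h1, smul_eq_mul, Finset.sum_const,
    Finset.card_univ, nsmul_eq_mul, mul_one]
  exact ENNReal.inv_mul_cancel (by exact_mod_cast Fintype.card_ne_zero) (ENNReal.natCast_ne_top _)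

theorem isProbabilityMeasure_mechanism (P : Protocol X Y O n m) (x : Fin n → X) :
    IsProbabilityMeasure (P.mechanism x) := by
  have := P.markov_analyzer
  have := P.isProbabilityMeasure_view x
  unfold mechanism
  infer_instance

end Protocol

end ShuffleModel

end

/-! Each user rounds `n * x` down to an integer, adds noise modulo `q`, and sends shares that are
uniform subject to summing to the noisy residue. The noise is a difference of two negative binomials
with parameter `1/n`. These are infinitely divisible, so the `n` contributions add up to a
difference of two geometric variables (`noise_add`, `sum_prod_modNoise`). With `α = exp (-ε / n)`,
shifting the total by at most `n` costs a factor `exp ε`, and after division by `n` the squared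
error is `O(1/ε²)`. Taking `q ≥ 4n²` ensures that wrap-around costs only a constant factor.

It remains to see that the shuffled shares reveal little beyond their total. For a matrix `v` of
messages, `hitProb v y` is the chance that the randomly permuted rows of `v` add up to `y`. The view
is a mixture of these (`viewMass_eq`), and ideally `hitProb v` would be uniform on the vectors with
the same total as `v`. The mean square deviation from this ideal is governed by a collision count,
which additive characters turn into moments of the probability that a random permutation fixes a
tuple `f` (`card_shuffle_kernel`, `sum_hitProb_sq`). Constant tuples produce exactly the ideal
value. A tuple with `t` distinct values is fixed with probability at most `n^(-(t-1)/2)`, so with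
many rows the other tuples contribute little (`sum_stabProb_pow_le`). Cauchy-Schwarz passes to L¹,
and one more uniform row replaces the average over `y` by a bound for every `y`
(`sum_abs_hitProb_succ_sub_le`).

The error decays geometrically in the number of rows, at rate a power of `n`. Hence a polynomially
large `q` costs only a constant number of rows, and `δ` costs `O(log (1/δ))` rows. -/

namespace ShuffleModel

open Finset

/-! ### Character sums and the kernel of the shuffled-sum map -/

section FiniteSums

theorem sum_apply_sum {A R : Type*} [AddCommGroup A] [Fintype A] [CommSemiring R] (m : ℕ)
    (F : A → R) :
    ∑ v : Fin (m + 1) → A, F (∑ j, v j) = (Fintype.card A : R) ^ m * ∑ y, F y := by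
  classical
  rw [← (Fin.consEquiv fun _ : Fin (m + 1) => A).sum_comp, Fintype.sum_prod_type_right]
  have h : ∀ u : Fin m → A, ∑ a : A, F (∑ j, Fin.consEquiv (fun _ => A) (a, u) j) = ∑ y, F y := by
    intro u
    simp only [Fin.sum_univ_succ, Fin.consEquiv_apply, Fin.cons_zero, Fin.cons_succ]
    exact Equiv.sum_comp (Equiv.addRight (∑ j, u j)) F
  simp only [h, sum_const, card_univ, Fintype.card_pi, prod_const, Fintype.card_fin, nsmul_eq_mul,
    Nat.cast_pow]

theorem stdAddChar_sum {q : ℕ} [NeZero q] {ι : Type*} (s : Finset ι) (f : ι → ZMod q) :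
    ZMod.stdAddChar (∑ i ∈ s, f i) = ∏ i ∈ s, ZMod.stdAddChar (f i) := by
  classical
  induction s using Finset.induction_on with
  | empty => simp
  | insert a s ha ih => rw [sum_insert ha, prod_insert ha, AddChar.map_add_eq_mul, ih]

theorem sum_stdAddChar_dot {q : ℕ} [NeZero q] {ι : Type*} [Fintype ι] [DecidableEq ι]
    (w : ι → ZMod q) :
    ∑ f : ι → ZMod q, ZMod.stdAddChar (∑ i, f i * w i) =
      if w = 0 then (q : ℂ) ^ Fintype.card ι else 0 := by
  have h : ∀ f : ι → ZMod q, ZMod.stdAddChar (∑ i, f i * w i) =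
      ∏ i, ZMod.stdAddChar (N := q) (f i * w i) := fun f => stdAddChar_sum _ _
  simp only [h]
  rw [← Fintype.prod_sum (fun i (x : ZMod q) => ZMod.stdAddChar (N := q) (x * w i))]
  simp only [AddChar.sum_mulShift _ (ZMod.isPrimitive_stdAddChar q), ZMod.card]
  split_ifs with hw
  · simp [hw]
  · obtain ⟨i, hi⟩ := Function.ne_iff.1 hw
    exact Finset.prod_eq_zero (mem_univ i) (by rw [if_neg (by simpa using hi), Nat.cast_zero])

/-- Evaluate a double character sum over `f` and `v` in two orders. Summing over `f` detects the
kernel of `v ↦ ∑ v j ∘ s j - ∑ v j`. Summing over `v` detects the kernel of the adjoint map, which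
consists of the tuples fixed by every `s j`. -/
theorem card_shuffle_kernel {q : ℕ} [NeZero q] {n M : ℕ} (s : Fin M → Equiv.Perm (Fin n)) :
    q ^ n * #{v : Fin M → Fin n → ZMod q | ∑ j, v j ∘ s j = ∑ j, v j} =
      q ^ (n * M) * #{f : Fin n → ZMod q | ∀ j, f ∘ s j = f} := by
  have key : ∀ (f : Fin n → ZMod q) (v : Fin M → Fin n → ZMod q),
      ∑ i, f i * (∑ j, v j ∘ s j - ∑ j, v j) i =
        ∑ j, ∑ i, v j i * (f ∘ (s j).symm - f) i := by
    intro f v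
    have h : ∀ j : Fin M, ∑ i, f i * v j (s j i) = ∑ i, v j i * f ((s j).symm i) := fun j => by
      rw [← Equiv.sum_comp (s j) fun i => v j i * f ((s j).symm i)]
      simp [mul_comm]
    simp only [Pi.sub_apply, Finset.sum_apply, Function.comp_apply, mul_sub, Finset.mul_sum,
      Finset.sum_sub_distrib]
    rw [Finset.sum_comm, Finset.sum_comm (s := univ (α := Fin n))]
    simp [h, mul_comm]
  have e1 : ∑ f : Fin n → ZMod q, ∑ v : Fin M → Fin n → ZMod q,
      ZMod.stdAddChar (∑ i, f i * (∑ j, v j ∘ s j - ∑ j, v j) i) =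
      ((q ^ n * #{v : Fin M → Fin n → ZMod q | ∑ j, v j ∘ s j = ∑ j, v j} : ℕ) : ℂ) := by
    rw [Finset.sum_comm]
    simp only [sum_stdAddChar_dot, sub_eq_zero]
    simp [Finset.sum_ite, mul_comm]
  have e2 : ∑ f : Fin n → ZMod q, ∑ v : Fin M → Fin n → ZMod q,
      ZMod.stdAddChar (∑ i, f i * (∑ j, v j ∘ s j - ∑ j, v j) i) =
      ((q ^ (n * M) * #{f : Fin n → ZMod q | ∀ j, f ∘ s j = f} : ℕ) : ℂ) := by
    have h : ∀ f : Fin n → ZMod q, ∑ v : Fin M → Fin n → ZMod q,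
        ZMod.stdAddChar (∑ j, ∑ i, v j i * (f ∘ (s j).symm - f) i) =
        if ∀ j, f ∘ s j = f then (q : ℂ) ^ (n * M) else 0 := by
      intro f
      have h1 : ∀ v : Fin M → Fin n → ZMod q,
          ZMod.stdAddChar (∑ j, ∑ i, v j i * (f ∘ (s j).symm - f) i) =
          ∏ j, ZMod.stdAddChar (N := q) (∑ i, v j i * (f ∘ (s j).symm - f) i) :=
        fun v => stdAddChar_sum _ _
      simp only [h1]
      rw [← Fintype.prod_sum (fun j (x : Fin n → ZMod q) =>
        ZMod.stdAddChar (N := q) (∑ i, x i * (f ∘ (s j).symm - f) i))]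
      simp only [sum_stdAddChar_dot, sub_eq_zero]
      have h2 : ∀ j, f ∘ (s j).symm = f ↔ f ∘ s j = f := fun j => by
        rw [Equiv.comp_symm_eq, eq_comm]
      simp only [h2]
      split_ifs with hf
      · simp [hf, pow_mul]
      · push Not at hf
        obtain ⟨j, hj⟩ := hf
        exact Finset.prod_eq_zero (mem_univ j) (by simp [hj])
    simp only [key, h]
    simp [Finset.sum_ite, mul_comm]
  exact_mod_cast e1.symm.trans e2

end FiniteSums

/-! ### Probability that a random permutation fixes a tuple -/

section Stabilizers

theorem factorial_mul_factorial_le (a b : ℕ) :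
    (a + 1).factorial * (b + 1).factorial ≤ (a + b + 1).factorial := by
  induction b with
  | zero => simp
  | succ b ih =>
    rw [Nat.factorial_succ (b + 1), show a + (b + 1) + 1 = (a + b + 1) + 1 by ring,
      Nat.factorial_succ (a + b + 1)]
    calc (a + 1).factorial * ((b + 1 + 1) * (b + 1).factorial)
        = (b + 1 + 1) * ((a + 1).factorial * (b + 1).factorial) := by ring
      _ ≤ _ := Nat.mul_le_mul (by omega) ih

theorem prod_factorial_succ_le {ι : Type*} (s : Finset ι) (k : ι → ℕ) :
    ∏ i ∈ s, (k i + 1).factorial ≤ (∑ i ∈ s, k i + 1).factorial := by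
  classical
  induction s using Finset.induction_on with
  | empty => simp
  | insert a s ha ih =>
    rw [prod_insert ha, sum_insert ha]
    exact (Nat.mul_le_mul_left _ ih).trans (factorial_mul_factorial_le _ _)

/-- In the square of `(d+1)⋯(d+s)`, pair each factor with its mirror image: every product
`(d+1+i)(d+s-i)` is at least `d+s`. -/
theorem factorial_sq_mul_pow_le (d s : ℕ) :
    d.factorial ^ 2 * (d + s) ^ s ≤ (d + s).factorial ^ 2 := by
  rw [← Nat.factorial_mul_ascFactorial, mul_pow]
  refine Nat.mul_le_mul_left _ ?_
  rw [sq, Nat.ascFactorial_eq_prod_range]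
  nth_rewrite 2 [← Finset.prod_range_reflect]
  rw [← prod_mul_distrib]
  calc (d + s) ^ s = ∏ i ∈ range s, (d + s) := by simp
    _ ≤ _ := by
      refine Finset.prod_le_prod' fun i hi => ?_
      obtain ⟨t, rfl⟩ := Nat.exists_eq_add_of_lt (mem_range.1 hi)
      rw [show i + t + 1 - 1 - i = t by omega]
      nlinarith [Nat.zero_le (i * t), Nat.zero_le (d * (i + t + 1)), Nat.zero_le (d * d)]

variable {G : Type*} [DecidableEq G] {n : ℕ}

/-- The number of permutations of the indices that leave the tuple `f` unchanged. -/
def stab (f : Fin n → G) : ℕ := #{s : Equiv.Perm (Fin n) | f ∘ s = f}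

/-- The number of indices at which the tuple `f` takes the value `g`. -/
def mult (f : Fin n → G) (g : G) : ℕ := #{i | f i = g}

/-- The graph of the multiplicity function of `f`, on the values that `f` takes. -/
def multGraph (f : Fin n → G) : Finset (G × ℕ) := (univ.image f).image fun g => (g, mult f g)

theorem stab_eq_prod (f : Fin n → G) : stab f = ∏ g ∈ univ.image f, (mult f g).factorial := by
  have := DomMulAct.stabilizer_card' f
  simp only [Fintype.card_subtype] at this
  exact this

theorem mult_pos {f : Fin n → G} {g : G} : g ∈ univ.image f ↔ 0 < mult f g := by
  simp [mult, card_pos, Finset.Nonempty]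

theorem sum_mult (f : Fin n → G) : ∑ g ∈ univ.image f, mult f g = n := by
  have := card_eq_sum_card_image f univ
  rw [card_univ, Fintype.card_fin] at this
  exact this.symm

theorem card_multGraph (f : Fin n → G) : #(multGraph f) = #(univ.image f) :=
  card_image_of_injective _ fun _ _ h => (Prod.ext_iff.1 h).1

theorem mem_multGraph {f : Fin n → G} {g : G} {k : ℕ} :
    (g, k) ∈ multGraph f ↔ 0 < k ∧ mult f g = k := by
  simp only [multGraph, mem_image (s := univ.image f), mult_pos, Prod.mk.injEq]
  constructor
  · rintro ⟨a, h, rfl, rfl⟩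
    exact ⟨h, rfl⟩
  · rintro ⟨h, rfl⟩
    exact ⟨g, h, rfl, rfl⟩

theorem mult_eq_of_multGraph_eq {f f' : Fin n → G} (h : multGraph f = multGraph f') :
    mult f = mult f' := by
  funext g
  rcases Nat.eq_zero_or_pos (mult f g) with h0 | h0
  · rcases Nat.eq_zero_or_pos (mult f' g) with h1 | h1
    · rw [h0, h1]
    · exact (mem_multGraph.1 (h ▸ mem_multGraph.2 ⟨h1, rfl⟩)).2
  · exact (mem_multGraph.1 (h ▸ mem_multGraph.2 ⟨h0, rfl⟩)).2.symm

theorem stab_eq_of_mult_eq {f f' : Fin n → G} (h : mult f = mult f') : stab f = stab f' := by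
  have hi : univ.image f = univ.image f' := by
    ext g
    rw [mult_pos, mult_pos, h]
  rw [stab_eq_prod, stab_eq_prod, h, hi]

theorem exists_perm_of_mult_eq {f f' : Fin n → G} (h : mult f = mult f') :
    ∃ s : Equiv.Perm (Fin n), f' ∘ s = f := by
  have e : ∀ g, Nonempty ({i // f i = g} ≃ {i // f' i = g}) := fun g => by
    refine ⟨Fintype.equivOfCardEq ?_⟩
    rw [Fintype.card_subtype, Fintype.card_subtype]
    exact congrFun h g
  exact ⟨Equiv.ofFiberEquiv fun g => (e g).some, funext fun i => Equiv.ofFiberEquiv_map _ i⟩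

/-- The stabilizer has order `∏ (mult f g)!`. With `t` distinct values this is at most `(n-t+1)!`,
by merging the factorials, and `factorial_sq_mul_pow_le` compares that with `n!`. -/
theorem stab_sq_mul_pow_le (f : Fin n → G) (hn : 0 < n) :
    stab f ^ 2 * n ^ (#(multGraph f) - 1) ≤ n.factorial ^ 2 := by
  rw [card_multGraph]
  have h1 : ∑ g ∈ univ.image f, (mult f g - 1) + #(univ.image f) = n := by
    rw [card_eq_sum_ones, ← sum_add_distrib]
    refine (sum_congr rfl fun g hg => ?_).trans (sum_mult f)
    have := mult_pos.1 hg
    omega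
  have h2 : stab f ≤ (∑ g ∈ univ.image f, (mult f g - 1) + 1).factorial := by
    rw [stab_eq_prod]
    refine le_trans (le_of_eq (prod_congr rfl fun g hg => ?_)) (prod_factorial_succ_le _ _)
    rw [Nat.sub_add_cancel (mult_pos.1 hg)]
  have h3 : 0 < #(univ.image f) :=
    card_pos.2 ⟨f ⟨0, hn⟩, mem_image_of_mem _ (mem_univ _)⟩
  have h4 := factorial_sq_mul_pow_le (∑ g ∈ univ.image f, (mult f g - 1) + 1)
    (#(univ.image f) - 1)
  rw [show ∑ g ∈ univ.image f, (mult f g - 1) + 1 + (#(univ.image f) - 1) = n by omega] at h4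
  exact (Nat.mul_le_mul_right _ (Nat.pow_le_pow_left h2 2)).trans h4

/-- The probability that a uniformly random permutation leaves `f` unchanged. -/
noncomputable def stabProb (f : Fin n → G) : ℝ := stab f / n.factorial

theorem stabProb_nonneg (f : Fin n → G) : 0 ≤ stabProb f := by unfold stabProb; positivity

/-- Tuples with equal multiplicities form a single orbit of the symmetric group, so by
orbit-stabilizer each has `stabProb` equal to the inverse of the orbit size. -/
theorem sum_stabProb_le_one [Fintype G] (T : Finset (G × ℕ)) :
    ∑ f : Fin n → G with multGraph f = T, stabProb f ≤ 1 := by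
  unfold stabProb
  rw [← sum_div, div_le_one (by positivity)]
  norm_cast
  rcases eq_empty_or_nonempty ({f : Fin n → G | multGraph f = T} : Finset _) with h | ⟨f₀, hf₀⟩
  · rw [h]; simp
  have hT : multGraph f₀ = T := by simpa using hf₀
  have h1 : ∀ f ∈ ({f : Fin n → G | multGraph f = T} : Finset _),
      stab f = #{s : Equiv.Perm (Fin n) | f₀ ∘ s = f} := by
    intro f hf
    have hf : multGraph f = T := by simpa using hf
    have hm := mult_eq_of_multGraph_eq (hf.trans hT.symm)
    obtain ⟨t, ht⟩ := exists_perm_of_mult_eq hm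
    rw [stab_eq_of_mult_eq hm]
    refine card_bij' (fun s _ => s * t) (fun s _ => s * t⁻¹) ?_ ?_ (by simp) (by simp)
    · intro s hs
      have hs : f₀ ∘ s = f₀ := by simpa using hs
      simp only [mem_filter, mem_univ, true_and, Equiv.Perm.coe_mul, ← Function.comp_assoc, hs, ht]
    · intro s hs
      have hs : f₀ ∘ s = f := by simpa using hs
      simp only [mem_filter, mem_univ, true_and, Equiv.Perm.coe_mul, ← Function.comp_assoc, hs]
      rw [← ht, Function.comp_assoc, ← Equiv.Perm.coe_mul]
      simp
  rw [sum_congr rfl h1, sum_card_fiberwise_eq_card_filter]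
  exact (card_le_univ _).trans (by rw [Fintype.card_perm, Fintype.card_fin])

/-- Expand `(1 + r)^#U` over subsets and remove those of size 0 and 1; what remains is the
second-order remainder of the exponential. -/
theorem sum_powerset_pow_le {ι : Type*} [DecidableEq ι] (U : Finset ι) {r : ℝ} (hr : 0 < r)
    (h : #U * r ≤ 1) :
    ∑ T ∈ U.powerset with 2 ≤ #T, r ^ (#T - 1) ≤ (#U : ℝ) ^ 2 * r := by
  have h1 : ∑ T ∈ U.powerset, r ^ #T = (r + 1) ^ #U := by
    simpa using Finset.sum_pow_mul_eq_add_pow r 1 U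
  have h2 : 1 + #U * r ≤ ∑ T ∈ U.powerset with ¬ 2 ≤ #T, r ^ #T := by
    have hd : Disjoint (powersetCard 0 U) (powersetCard 1 U) :=
      pairwise_disjoint_powersetCard U (by norm_num : (0 : ℕ) ≠ 1)
    have h3 : ∑ T ∈ powersetCard 0 U ∪ powersetCard 1 U, r ^ #T = 1 + #U * r := by
      rw [sum_union hd, sum_powersetCard, sum_powersetCard]
      simp
    rw [← h3]
    refine sum_le_sum_of_subset_of_nonneg ?_ fun T _ _ => by positivity
    intro T hT
    rw [mem_union, mem_powersetCard, mem_powersetCard] at hT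
    rw [mem_filter, mem_powerset]
    rcases hT with hT | hT <;> exact ⟨hT.1, by omega⟩
  have h3 : (r + 1) ^ #U ≤ 1 + #U * r + (#U * r) ^ 2 := by
    have h4 : (r + 1) ^ #U ≤ Real.exp (#U * r) := by
      rw [Real.exp_nat_mul]
      exact pow_le_pow_left₀ (by positivity) (Real.add_one_le_exp r) _
    have h5 := Real.abs_exp_sub_one_sub_id_le (x := #U * r) (by rwa [abs_of_nonneg (by positivity)])
    have := le_of_abs_le h5
    linarith
  have h4 : (∑ T ∈ U.powerset with 2 ≤ #T, r ^ (#T - 1)) * r =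
      ∑ T ∈ U.powerset with 2 ≤ #T, r ^ #T := by
    rw [sum_mul]
    refine sum_congr rfl fun T hT => ?_
    have := (mem_filter.1 hT).2
    rw [← pow_succ, Nat.sub_add_cancel (by omega)]
  have h5 := sum_filter_add_sum_filter_not U.powerset (fun T => 2 ≤ #T) (fun T => r ^ #T)
  refine le_of_mul_le_mul_right ?_ hr
  rw [h4]
  linarith [h5.trans h1]

/-- Of the `2h+1` factors, one sums to at most 1 over each orbit, and the other `2h` give
`n^(-h(t-1))`. Orbits are indexed by subsets of `G × [1, n]` with `t` elements, so
`sum_powerset_pow_le` adds up the orbits with `t ≥ 2`. The constant tuples account for the leading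
term. -/
theorem sum_stabProb_pow_le [Fintype G] [Nonempty G] (hn : 0 < n) (h : ℕ)
    (hr : (Fintype.card G * n : ℝ) * ((n : ℝ) ^ h)⁻¹ ≤ 1) :
    ∑ f : Fin n → G, stabProb f ^ (2 * h + 1) ≤
      Fintype.card G + (Fintype.card G * n : ℝ) ^ 2 * ((n : ℝ) ^ h)⁻¹ := by
  have hn' : (0 : ℝ) < n := by exact_mod_cast hn
  set r : ℝ := ((n : ℝ) ^ h)⁻¹ with hrdef
  have hr0 : 0 < r := by positivity
  have hp : ∀ f : Fin n → G,
      stabProb f ^ (2 * h + 1) ≤ stabProb f * r ^ (#(multGraph f) - 1) := by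
    intro f
    have h1 : stabProb f ^ 2 ≤ ((n : ℝ) ^ (#(multGraph f) - 1))⁻¹ := by
      unfold stabProb
      rw [div_pow, le_inv_comm₀ (by
        have : 0 < stab f := card_pos.2 ⟨1, by simp⟩
        positivity) (by positivity), inv_div, le_div_iff₀ (by
        have : 0 < stab f := card_pos.2 ⟨1, by simp⟩
        positivity), mul_comm]
      exact_mod_cast stab_sq_mul_pow_le f hn
    rw [pow_succ, pow_mul, mul_comm]
    refine mul_le_mul_of_nonneg_left ?_ (stabProb_nonneg f)
    calc (stabProb f ^ 2) ^ h ≤ (((n : ℝ) ^ (#(multGraph f) - 1))⁻¹) ^ h :=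
          pow_le_pow_left₀ (by positivity) h1 _
      _ = r ^ (#(multGraph f) - 1) := by rw [hrdef, inv_pow, inv_pow, ← pow_mul, ← pow_mul, mul_comm]
  set U : Finset (G × ℕ) := univ ×ˢ Icc 1 n with hU
  have hUc : (#U : ℝ) = Fintype.card G * n := by simp [hU]
  have hmem : ∀ f : Fin n → G, multGraph f ∈ U.powerset := by
    intro f
    rw [mem_powerset]
    rintro ⟨g, k⟩ hk
    obtain ⟨h1, rfl⟩ := mem_multGraph.1 hk
    have h2 : mult f g ≤ n := by simpa [mult] using card_le_univ ({i | f i = g} : Finset (Fin n))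
    simp [hU]
    omega
  have hbig : ∑ f : Fin n → G with 2 ≤ #(multGraph f), stabProb f ^ (2 * h + 1) ≤ #U ^ 2 * r := by
    refine le_trans ?_ (sum_powerset_pow_le U hr0 (by rwa [hUc]))
    rw [← sum_fiberwise_of_maps_to (s := {f : Fin n → G | 2 ≤ #(multGraph f)})
      (t := {T ∈ U.powerset | 2 ≤ #T}) (g := multGraph)
      (fun f hf => mem_filter.2 ⟨hmem f, (mem_filter.1 hf).2⟩)]
    refine sum_le_sum fun T hT => ?_
    calc _ ≤ ∑ f : Fin n → G with multGraph f = T, stabProb f * r ^ (#T - 1) := by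
            refine (sum_le_sum fun f _ => hp f).trans ?_
            rw [filter_filter]
            refine (sum_le_sum_of_subset_of_nonneg (t := {f : Fin n → G | multGraph f = T}) ?_ ?_).trans
              (le_of_eq (sum_congr rfl fun f hf => by rw [(mem_filter.1 hf).2]))
            · intro f hf
              simp only [mem_filter, mem_univ, true_and] at hf ⊢
              exact hf.2
            · intro f _ _
              have := stabProb_nonneg f
              positivity
      _ ≤ _ := by
            rw [← sum_mul]
            exact mul_le_of_le_one_left (by positivity) (sum_stabProb_le_one T)
  have hsmall : ∑ f : Fin n → G with ¬ 2 ≤ #(multGraph f), stabProb f ^ (2 * h + 1) ≤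
      Fintype.card G := by
    have h1 : #{f : Fin n → G | ¬ 2 ≤ #(multGraph f)} ≤ Fintype.card G := by
      rw [← card_univ (α := G), ← card_image_of_injective (univ : Finset G)
        (f := fun g (_ : Fin n) => g) (fun a b hab => congrFun hab ⟨0, hn⟩)]
      refine card_le_card fun f hf => ?_
      rw [mem_filter, card_multGraph] at hf
      refine mem_image.2 ⟨f ⟨0, hn⟩, mem_univ _, funext fun i => ?_⟩
      exact card_le_one.1 (by omega) _ (mem_image_of_mem f (mem_univ _)) _
        (mem_image_of_mem f (mem_univ _))
    have h2 : ∀ f : Fin n → G, stabProb f ^ (2 * h + 1) ≤ 1 := fun f => by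
      refine pow_le_one₀ (stabProb_nonneg f) ?_
      unfold stabProb
      rw [div_le_one (by positivity)]
      exact_mod_cast (card_le_univ _).trans (by rw [Fintype.card_perm, Fintype.card_fin])
    calc _ ≤ ∑ f : Fin n → G with ¬ 2 ≤ #(multGraph f), (1 : ℝ) := sum_le_sum fun f _ => h2 f
      _ ≤ _ := by simpa using h1
  rw [← sum_filter_add_sum_filter_not univ (fun f : Fin n → G => 2 ≤ #(multGraph f)), ← hUc]
  linarith

end Stabilizers

end ShuffleModel

namespace ShuffleModel

open Finset

/-! ### Shuffled sums are nearly uniform given their total -/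

section Smoothing

variable {q n : ℕ}

/-- The probability that the rows of `v`, permuted independently and uniformly at random, add up
to `y`. -/
noncomputable def hitProb {M : ℕ} (v : Fin M → Fin n → ZMod q) (y : Fin n → ZMod q) : ℝ :=
  (∑ s : Fin M → Equiv.Perm (Fin n), if ∑ j, v j ∘ s j = y then 1 else 0) / n.factorial ^ M

/-- The indicator of the event that the entries of `v` have the same sum as those of `y`. -/
noncomputable def sameSum {M : ℕ} (v : Fin M → Fin n → ZMod q) (y : Fin n → ZMod q) : ℝ :=
  if ∑ j, ∑ i, v j i = ∑ i, y i then 1 else 0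

theorem sum_sum_comp_perm {M : ℕ} (v : Fin M → Fin n → ZMod q)
    (s : Fin M → Equiv.Perm (Fin n)) : ∑ i, (∑ j, v j ∘ s j) i = ∑ j, ∑ i, v j i := by
  simp only [Finset.sum_apply, Function.comp_apply]
  rw [Finset.sum_comm]
  exact sum_congr rfl fun j _ => Equiv.sum_comp (s j) (v j)

theorem hitProb_mul_sameSum {M : ℕ} (v : Fin M → Fin n → ZMod q) (y : Fin n → ZMod q) :
    hitProb v y * sameSum v y = hitProb v y := by
  unfold sameSum
  split_ifs with h
  · simp
  · have : hitProb v y = 0 := by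
      unfold hitProb
      rw [sum_eq_zero, zero_div]
      intro s _
      rw [if_neg]
      rintro rfl
      exact h (sum_sum_comp_perm v s).symm
    simp [this]

theorem hitProb_cons {M : ℕ} (s : Fin n → ZMod q) (v : Fin M → Fin n → ZMod q)
    (y : Fin n → ZMod q) :
    hitProb (Fin.cons s v : Fin (M + 1) → Fin n → ZMod q) y =
      (∑ t : Equiv.Perm (Fin n), hitProb v (y - s ∘ t)) / n.factorial := by
  unfold hitProb
  rw [← (Fin.consEquiv fun _ : Fin (M + 1) => Equiv.Perm (Fin n)).sum_comp,
    Fintype.sum_prod_type, ← sum_div, div_div, ← pow_succ]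
  congr 1
  refine sum_congr rfl fun t _ => sum_congr rfl fun p _ => ?_
  simp only [Fin.sum_univ_succ, Fin.consEquiv_apply, Fin.cons_zero, Fin.cons_succ]
  simp only [eq_sub_iff_add_eq, add_comm]

variable [NeZero q]

theorem card_perm_pi (n M : ℕ) :
    ((Fintype.card (Fin M → Equiv.Perm (Fin n)) : ℕ) : ℝ) = (n.factorial : ℝ) ^ M := by
  simp [Fintype.card_perm]

theorem sum_hitProb {M : ℕ} (v : Fin M → Fin n → ZMod q) : ∑ y, hitProb v y = 1 := by
  unfold hitProb
  rw [← sum_div, sum_comm]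
  have : (n.factorial : ℝ) ^ M ≠ 0 := by positivity
  simp [Fintype.card_perm, div_self this]

/-- The sum of squares counts collisions between two independent shuffles `s` and `s'` of the same
`v`. Relabelling the rows of `v` by `s'` makes one of the shuffles trivial, so `card_shuffle_kernel`
applies. -/
theorem sum_hitProb_sq {M : ℕ} :
    (q : ℝ) ^ n * ∑ v : Fin M → Fin n → ZMod q, ∑ y, hitProb v y ^ 2 =
      (q : ℝ) ^ (n * M) * ∑ f : Fin n → ZMod q, stabProb f ^ M := by
  have hN : (n.factorial : ℝ) ^ M ≠ 0 := by positivity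
  have h1 : ∀ v : Fin M → Fin n → ZMod q, ∑ y, hitProb v y ^ 2 =
      (∑ s' : Fin M → Equiv.Perm (Fin n), ∑ s : Fin M → Equiv.Perm (Fin n),
        if ∑ j, v j ∘ s j = ∑ j, v j ∘ s' j then (1 : ℝ) else 0) / (n.factorial ^ M) ^ 2 := by
    intro v
    simp only [hitProb, div_pow]
    rw [← sum_div]
    congr 1
    have h0 : ∀ y, (∑ s : Fin M → Equiv.Perm (Fin n),
        if ∑ j, v j ∘ s j = y then (1 : ℝ) else 0) ^ 2 =
        ∑ s' : Fin M → Equiv.Perm (Fin n), ∑ s : Fin M → Equiv.Perm (Fin n),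
          if ∑ j, v j ∘ s j = y then (if ∑ j, v j ∘ s' j = y then (1 : ℝ) else 0) else 0 := by
      intro y
      rw [sq, sum_mul_sum, sum_comm]
      simp only [ite_mul, one_mul, zero_mul]
    simp only [h0]
    rw [sum_comm]
    refine sum_congr rfl fun s' _ => ?_
    rw [sum_comm]
    refine sum_congr rfl fun s _ => ?_
    rw [sum_ite_eq, if_pos (mem_univ _)]
    simp only [eq_comm]
  have h2 : ∀ s' : Fin M → Equiv.Perm (Fin n),
      ∑ v : Fin M → Fin n → ZMod q, ∑ s : Fin M → Equiv.Perm (Fin n),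
        (if ∑ j, v j ∘ s j = ∑ j, v j ∘ s' j then (1 : ℝ) else 0) =
      ∑ s : Fin M → Equiv.Perm (Fin n),
        (#{v : Fin M → Fin n → ZMod q | ∑ j, v j ∘ s j = ∑ j, v j} : ℝ) := by
    intro s'
    rw [← Equiv.sum_comp (Equiv.piCongrRight fun j => (s' j).arrowCongr (Equiv.refl (ZMod q)))]
    rw [sum_comm, ← Equiv.sum_comp (Equiv.mulLeft s')]
    refine sum_congr rfl fun s _ => ?_
    rw [sum_boole]
    congr 2
    ext v
    have e1 : ∀ j, (s' j).arrowCongr (Equiv.refl (ZMod q)) (v j) ∘ ⇑((s' * s) j) = v j ∘ s j := by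
      intro j
      ext i
      simp [Equiv.arrowCongr]
    have e2 : ∀ j, (s' j).arrowCongr (Equiv.refl (ZMod q)) (v j) ∘ ⇑(s' j) = v j := by
      intro j
      ext i
      simp [Equiv.arrowCongr]
    simp only [mem_filter, mem_univ, true_and, Equiv.piCongrRight_apply, Pi.map_apply,
      Equiv.coe_mulLeft, e1, e2]
  have h3 : ∑ s : Fin M → Equiv.Perm (Fin n), (#{f : Fin n → ZMod q | ∀ j, f ∘ s j = f} : ℝ) =
      ∑ f : Fin n → ZMod q, (stab f : ℝ) ^ M := by
    simp only [← sum_boole]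
    rw [sum_comm]
    refine sum_congr rfl fun f _ => ?_
    rw [sum_boole]
    have : ({s : Fin M → Equiv.Perm (Fin n) | ∀ j, f ∘ s j = f} : Finset _) =
        Fintype.piFinset fun _ => {s : Equiv.Perm (Fin n) | f ∘ s = f} := by
      ext s
      simp [Fintype.mem_piFinset]
    rw [this, Fintype.card_piFinset]
    simp [stab]
  have h4 : (q : ℝ) ^ n * ∑ s : Fin M → Equiv.Perm (Fin n),
      (#{v : Fin M → Fin n → ZMod q | ∑ j, v j ∘ s j = ∑ j, v j} : ℝ) =
      (q : ℝ) ^ (n * M) * ∑ f : Fin n → ZMod q, (stab f : ℝ) ^ M := by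
    rw [← h3, mul_sum, mul_sum]
    exact sum_congr rfl fun s _ => by exact_mod_cast card_shuffle_kernel (q := q) s
  simp only [h1, stabProb, div_pow]
  rw [← sum_div, ← sum_div, sum_comm, sum_congr rfl fun s' _ => h2 s', sum_const, card_univ,
    nsmul_eq_mul, card_perm_pi, ← mul_div_assoc, ← mul_div_assoc, mul_left_comm, h4]
  field_simp

theorem sum_sameSum {k M : ℕ} (v : Fin M → Fin (k + 1) → ZMod q) :
    ∑ y, sameSum v y = (q : ℝ) ^ k := by
  unfold sameSum
  rw [sum_apply_sum (A := ZMod q) k fun g => if ∑ j, ∑ i, v j i = g then (1 : ℝ) else 0]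
  simp

/-- Cauchy-Schwarz against the indicator `sameSum`: restricting to its support, rather than to all
`y`, is what makes the second factor a variance with the leading 1 subtracted. -/
theorem sum_abs_hitProb_sub_sq_le {k M : ℕ} :
    (∑ v : Fin M → Fin (k + 1) → ZMod q, ∑ y, |hitProb v y - sameSum v y * ((q : ℝ) ^ k)⁻¹|) ^ 2 ≤
      ((q : ℝ) ^ ((k + 1) * M)) ^ 2 *
        ((∑ f : Fin (k + 1) → ZMod q, stabProb f ^ M) / q - 1) := by
  have hq : (0 : ℝ) < q := by exact_mod_cast Nat.pos_of_ne_zero (NeZero.ne q)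
  have hs01 : ∀ (v : Fin M → Fin (k + 1) → ZMod q) (y : Fin (k + 1) → ZMod q),
      sameSum v y = 0 ∨ sameSum v y = 1 := fun v y => by unfold sameSum; split_ifs <;> simp
  have hs : ∀ (v : Fin M → Fin (k + 1) → ZMod q) (y : Fin (k + 1) → ZMod q),
      sameSum v y ^ 2 = sameSum v y := fun v y => by unfold sameSum; split_ifs <;> simp
  have hcard : ∑ v : Fin M → Fin (k + 1) → ZMod q, (1 : ℝ) = (q : ℝ) ^ ((k + 1) * M) := by
    simp [pow_mul]
  have h1 : ∀ (v : Fin M → Fin (k + 1) → ZMod q) (y : Fin (k + 1) → ZMod q),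
      |hitProb v y - sameSum v y * ((q : ℝ) ^ k)⁻¹| =
        sameSum v y * |hitProb v y - sameSum v y * ((q : ℝ) ^ k)⁻¹| := by
    intro v y
    have h0 := hitProb_mul_sameSum v y
    rcases hs01 v y with h | h
    · rw [h, mul_zero] at h0
      simp [← h0, h]
    · simp only [h, one_mul]
  have h2 : ∑ v : Fin M → Fin (k + 1) → ZMod q, ∑ y, |hitProb v y - sameSum v y * ((q : ℝ) ^ k)⁻¹| ^ 2 =
      ∑ v : Fin M → Fin (k + 1) → ZMod q, ∑ y, hitProb v y ^ 2 -
        (q : ℝ) ^ ((k + 1) * M) * ((q : ℝ) ^ k)⁻¹ := by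
    have h3 : ∀ v : Fin M → Fin (k + 1) → ZMod q,
        ∑ y, |hitProb v y - sameSum v y * ((q : ℝ) ^ k)⁻¹| ^ 2 =
        ∑ y, hitProb v y ^ 2 - ((q : ℝ) ^ k)⁻¹ * 1 := by
      intro v
      have h4 : ∀ y, |hitProb v y - sameSum v y * ((q : ℝ) ^ k)⁻¹| ^ 2 =
          hitProb v y ^ 2 - 2 * ((q : ℝ) ^ k)⁻¹ * hitProb v y +
            (((q : ℝ) ^ k)⁻¹) ^ 2 * sameSum v y := fun y => by
        have h0 := hitProb_mul_sameSum v y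
        rw [sq_abs]
        rcases hs01 v y with h | h
        · rw [h, mul_zero] at h0
          simp [← h0, h]
        · rw [h]
          ring
      simp only [h4, sum_add_distrib, sum_sub_distrib, ← mul_sum, sum_hitProb, sum_sameSum]
      field_simp
      ring
    simp only [h3, sum_sub_distrib, ← mul_sum, hcard]
    ring
  have h5 : ∑ v : Fin M → Fin (k + 1) → ZMod q, ∑ y, sameSum v y ^ 2 =
      (q : ℝ) ^ ((k + 1) * M) * (q : ℝ) ^ k := by
    simp only [hs, sum_sameSum]
    rw [← hcard, sum_mul]
    simp
  have h6 := sum_mul_sq_le_sq_mul_sq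
    (univ : Finset ((Fin M → Fin (k + 1) → ZMod q) × (Fin (k + 1) → ZMod q)))
    (fun p => sameSum p.1 p.2) (fun p => |hitProb p.1 p.2 - sameSum p.1 p.2 * ((q : ℝ) ^ k)⁻¹|)
  simp only [Fintype.sum_prod_type] at h6
  rw [h5, h2] at h6
  simp only [← h1] at h6
  refine h6.trans (le_of_eq ?_)
  have h7 := sum_hitProb_sq (q := q) (n := k + 1) (M := M)
  have h8 : ∑ v : Fin M → Fin (k + 1) → ZMod q, ∑ y, hitProb v y ^ 2 =
      (q : ℝ) ^ ((k + 1) * M) * (∑ f : Fin (k + 1) → ZMod q, stabProb f ^ M) / (q : ℝ) ^ (k + 1) := by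
    rw [← h7]
    field_simp
  rw [h8]
  field_simp
  ring

/-- Condition on the permutation `t` of the extra row `s`. As `s` runs over all vectors, so does the
residual target `y - s ∘ t`, whatever `y` is. -/
theorem sum_abs_hitProb_succ_sub_le {M : ℕ} (y : Fin n → ZMod q) (c : ℝ) :
    ∑ v : Fin (M + 1) → Fin n → ZMod q, |hitProb v y - sameSum v y * c| ≤
      ∑ v : Fin M → Fin n → ZMod q, ∑ u, |hitProb v u - sameSum v u * c| := by
  have hN : (n.factorial : ℝ) ≠ 0 := by positivity
  rw [← (Fin.consEquiv fun _ : Fin (M + 1) => Fin n → ZMod q).sum_comp,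
    Fintype.sum_prod_type_right]
  refine sum_le_sum fun v _ => ?_
  have h1 : ∀ s : Fin n → ZMod q, |hitProb (Fin.consEquiv (fun _ => Fin n → ZMod q) (s, v)) y -
      sameSum (Fin.consEquiv (fun _ : Fin (M + 1) => Fin n → ZMod q) (s, v)) y * c| ≤
      (∑ t : Equiv.Perm (Fin n), |hitProb v (y - s ∘ t) - sameSum v (y - s ∘ t) * c|) /
        n.factorial := by
    intro s
    have h2 : ∀ t : Equiv.Perm (Fin n), sameSum v (y - s ∘ t) =
        sameSum (Fin.consEquiv (fun _ : Fin (M + 1) => Fin n → ZMod q) (s, v)) y := by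
      intro t
      have h3 := Equiv.sum_comp t s
      simp only [sameSum, Fin.sum_univ_succ, Fin.consEquiv_apply, Fin.cons_zero, Fin.cons_succ,
        Pi.sub_apply, Function.comp_apply, sum_sub_distrib, h3, eq_sub_iff_add_eq, add_comm]
    simp only [h2]
    rw [le_div_iff₀ (by positivity), ← abs_of_nonneg (show (0 : ℝ) ≤ n.factorial by positivity),
      ← abs_mul]
    refine le_trans (le_of_eq ?_) (abs_sum_le_sum_abs _ _)
    congr 1
    have h3 : hitProb (Fin.consEquiv (fun _ => Fin n → ZMod q) (s, v)) y = _ := hitProb_cons s v y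
    rw [h3, sum_sub_distrib, sub_mul, div_mul_cancel₀ _ hN]
    simp [Fintype.card_perm, mul_comm]
  refine (sum_le_sum fun s _ => h1 s).trans (le_of_eq ?_)
  rw [← sum_div, sum_comm, div_eq_iff hN]
  have h4 : ∀ t : Equiv.Perm (Fin n),
      ∑ s : Fin n → ZMod q, |hitProb v (y - s ∘ t) - sameSum v (y - s ∘ t) * c| =
      ∑ u, |hitProb v u - sameSum v u * c| := fun t =>
    Equiv.sum_comp ((t.symm.arrowCongr (Equiv.refl (ZMod q))).trans (Equiv.subLeft y))
      fun u => |hitProb v u - sameSum v u * c|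
  simp only [h4]
  simp [Fintype.card_perm, mul_comm]

theorem sum_abs_hitProb_sub_le {k h : ℕ} {γ : ℝ} (hγ0 : 0 ≤ γ) (hγ1 : γ ≤ 1)
    (hγ : q * ((k + 1 : ℕ) : ℝ) ^ 2 * (((k + 1 : ℕ) : ℝ) ^ h)⁻¹ ≤ γ ^ 2)
    (y : Fin (k + 1) → ZMod q) :
    ∑ v : Fin (2 * h + 1 + 1) → Fin (k + 1) → ZMod q,
      |hitProb v y - sameSum v y * ((q : ℝ) ^ k)⁻¹| ≤ (q : ℝ) ^ ((k + 1) * (2 * h + 1)) * γ := by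
  have hq : (0 : ℝ) < q := by exact_mod_cast Nat.pos_of_ne_zero (NeZero.ne q)
  refine (sum_abs_hitProb_succ_sub_le y _).trans (abs_le_of_sq_le_sq' ?_ (by positivity)).2
  refine sum_abs_hitProb_sub_sq_le.trans ?_
  rw [mul_pow]
  refine mul_le_mul_of_nonneg_left ?_ (by positivity)
  set r : ℝ := (((k + 1 : ℕ) : ℝ) ^ h)⁻¹ with hr
  have hr0 : 0 < r := by positivity
  have hn : (1 : ℝ) ≤ ((k + 1 : ℕ) : ℝ) := by exact_mod_cast Nat.succ_le_succ (Nat.zero_le k)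
  have h1 := sum_stabProb_pow_le (G := ZMod q) (n := k + 1) (Nat.succ_pos k) h (by
    rw [ZMod.card, ← hr]
    refine le_trans ?_ (hγ.trans (pow_le_one₀ hγ0 hγ1))
    gcongr
    nlinarith)
  rw [ZMod.card, ← hr] at h1
  have h2 : (∑ f : Fin (k + 1) → ZMod q, stabProb f ^ (2 * h + 1)) / q ≤
      1 + q * ((k + 1 : ℕ) : ℝ) ^ 2 * r := by
    rw [div_le_iff₀ hq]
    refine h1.trans (le_of_eq ?_)
    ring
  linarith

end Smoothing

end ShuffleModel

namespace ShuffleModel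

open scoped NNReal

/-! ### Infinitely divisible noise and its reduction modulo `q` -/

section Noise

theorem multichoose_nonneg (r : ℝ≥0) (k : ℕ) : 0 ≤ Ring.multichoose (r : ℝ) k := by
  rcases eq_or_ne r 0 with rfl | hr
  · cases k with
    | zero => simp
    | succ k => rw [NNReal.coe_zero, Ring.multichoose_zero_succ]
  · have h := Ring.factorial_nsmul_multichoose_eq_ascPochhammer (r : ℝ) k
    rw [Polynomial.ascPochhammer_smeval_eq_eval, nsmul_eq_mul] at h
    have h1 := ascPochhammer_pos k (r : ℝ) (NNReal.coe_pos.2 (pos_iff_ne_zero.2 hr))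
    rw [← h] at h1
    exact (pos_of_mul_pos_right h1 (by positivity)).le

/-- Vandermonde's identity for the negative upper arguments `-r` and `-s`, with the common sign
cancelled. -/
theorem multichoose_add (r s : ℝ) (k : ℕ) : Ring.multichoose (r + s) k =
    ∑ p ∈ Finset.HasAntidiagonal.antidiagonal k, Ring.multichoose r p.1 * Ring.multichoose s p.2 := by
  have h := Ring.add_choose_eq k (Commute.all (-r) (-s))
  rw [← neg_add, Ring.choose_neg'] at h
  have h1 : ∀ p ∈ Finset.HasAntidiagonal.antidiagonal k, Ring.choose (-r) p.1 * Ring.choose (-s) p.2 =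
      Int.negOnePow k • (Ring.multichoose r p.1 * Ring.multichoose s p.2) := by
    intro p hp
    rw [Ring.choose_neg', Ring.choose_neg', ← Finset.HasAntidiagonal.mem_antidiagonal.1 hp, Nat.cast_add,
      Int.negOnePow_add, smul_mul_smul_comm]
  rw [Finset.sum_congr rfl h1, ← Finset.smul_sum] at h
  exact smul_left_cancel _ h

theorem hasSum_multichoose_mul_pow (r : ℝ) {α : ℝ} (hα : α ∈ Set.Ioo (0 : ℝ) 1) :
    HasSum (fun k => Ring.multichoose r k * α ^ k) (1 / (1 - α) ^ r) := by
  have h := (Real.one_div_one_sub_rpow_hasFPowerSeriesOnBall_zero r).hasSum (y := α) (by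
    simp [Metric.mem_eball, edist_dist, abs_of_pos hα.1, hα.2])
  simpa [FormalMultilinearSeries.ofScalars_apply_eq, ← Ring.multichoose_eq, mul_comm] using h

/-- The negative binomial distribution with parameter `α` and (not necessarily integral)
number of failures `r`. -/
noncomputable def negBinomial {α : ℝ} (hα : α ∈ Set.Ioo (0 : ℝ) 1) (r : ℝ≥0) : PMF ℕ :=
  ⟨fun k => ENNReal.ofReal ((1 - α) ^ (r : ℝ) * (Ring.multichoose (r : ℝ) k * α ^ k)), by
    have h0 : 0 < 1 - α := sub_pos.2 hα.2
    have h := (hasSum_multichoose_mul_pow r hα).mul_left ((1 - α) ^ (r : ℝ))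
    rw [mul_one_div_cancel (Real.rpow_pos_of_pos h0 _).ne'] at h
    have hn : ∀ k, 0 ≤ (1 - α) ^ (r : ℝ) * (Ring.multichoose (r : ℝ) k * α ^ k) := fun k => by
      have := multichoose_nonneg r k
      have := hα.1
      positivity
    rw [ENNReal.summable.hasSum_iff, ← ENNReal.ofReal_tsum_of_nonneg hn h.summable, h.tsum_eq,
      ENNReal.ofReal_one]⟩

variable {α : ℝ} (hα : α ∈ Set.Ioo (0 : ℝ) 1)

theorem negBinomial_apply (r : ℝ≥0) (k : ℕ) : negBinomial hα r k =
    ENNReal.ofReal ((1 - α) ^ (r : ℝ) * (Ring.multichoose (r : ℝ) k * α ^ k)) := rfl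

theorem negBinomial_one_apply (k : ℕ) :
    negBinomial hα 1 k = ENNReal.ofReal ((1 - α) * α ^ k) := by
  simp [negBinomial_apply]

theorem negBinomial_add (r s : ℝ≥0) : negBinomial hα (r + s) =
    (negBinomial hα r).bind fun i => (negBinomial hα s).bind fun j => PMF.pure (i + j) := by
  have h0 : 0 < 1 - α := sub_pos.2 hα.2
  ext k
  simp only [PMF.bind_apply, PMF.pure_apply, ← ENNReal.tsum_mul_left]
  have hm : ∀ (t : ℝ≥0) (j : ℕ), 0 ≤ (1 - α) ^ (t : ℝ) * (Ring.multichoose (t : ℝ) j * α ^ j) :=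
    fun t j => by
      have := multichoose_nonneg t j
      have := hα.1
      positivity
  rw [← ENNReal.tsum_prod, tsum_eq_sum (s := Finset.HasAntidiagonal.antidiagonal k) (by
    intro p hp
    rw [Finset.HasAntidiagonal.mem_antidiagonal] at hp
    rw [if_neg (Ne.symm hp), mul_zero, mul_zero]), negBinomial_apply, NNReal.coe_add,
    multichoose_add, Real.rpow_add h0, Finset.sum_mul, Finset.mul_sum,
    ENNReal.ofReal_sum_of_nonneg]
  · refine Finset.sum_congr rfl fun p hp => ?_
    rw [Finset.HasAntidiagonal.mem_antidiagonal] at hp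
    rw [if_pos hp.symm, mul_one, negBinomial_apply, negBinomial_apply, ← ENNReal.ofReal_mul (hm _ _),
      ← hp]
    congr 1
    ring
  · intro p hp
    have := multichoose_nonneg r p.1
    have := multichoose_nonneg s p.2
    have := hα.1
    positivity

/-- The difference of two independent negative binomial variables. -/
noncomputable def noise (r : ℝ≥0) : PMF ℤ :=
  (negBinomial hα r).bind fun k => (negBinomial hα r).bind fun l => PMF.pure ((k : ℤ) - l)

theorem noise_add (r s : ℝ≥0) : noise hα (r + s) =
    (noise hα r).bind fun a => (noise hα s).bind fun b => PMF.pure (a + b) := by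
  simp only [noise, negBinomial_add, PMF.bind_bind, PMF.pure_bind]
  congr 1
  funext k
  rw [PMF.bind_comm]
  congr 1
  funext l
  congr 1
  funext k'
  congr 1
  funext l'
  congr 1
  push_cast
  ring

theorem tsum_bind_mul {β γ : Type*} (p : PMF β) (f : β → PMF γ) (F : γ → ℝ≥0∞) :
    ∑' c, p.bind f c * F c = ∑' b, p b * ∑' c, f b c * F c := by
  simp only [PMF.bind_apply, ← ENNReal.tsum_mul_right, ← ENNReal.tsum_mul_left]
  rw [ENNReal.tsum_comm]
  simp only [mul_assoc]

theorem tsum_pure_mul {β : Type*} (b : β) (F : β → ℝ≥0∞) : ∑' c, PMF.pure b c * F c = F b := by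
  rw [tsum_eq_single b fun c hc => by simp [PMF.pure_apply, hc]]
  simp

theorem tsum_noise_mul (r : ℝ≥0) (F : ℤ → ℝ≥0∞) : ∑' z, noise hα r z * F z =
    ∑' k, negBinomial hα r k * ∑' l, negBinomial hα r l * F ((k : ℤ) - l) := by
  simp only [noise, tsum_bind_mul, tsum_pure_mul]

/-- For parameter 1 the law is geometric, with consecutive masses in ratio `α`; only the term at 0
is lost. -/
theorem tsum_negBinomial_succ_le (F : ℕ → ℝ≥0∞) :
    ∑' k, negBinomial hα 1 k * F (k + 1) ≤
      ENNReal.ofReal α⁻¹ * ∑' k, negBinomial hα 1 k * F k := by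
  have h : ∀ k, negBinomial hα 1 k = ENNReal.ofReal α⁻¹ * negBinomial hα 1 (k + 1) := fun k => by
    have := hα.1
    rw [negBinomial_one_apply, negBinomial_one_apply, ← ENNReal.ofReal_mul (by positivity)]
    congr 1
    field_simp
    ring
  calc ∑' k, negBinomial hα 1 k * F (k + 1)
      = ENNReal.ofReal α⁻¹ * ∑' k, negBinomial hα 1 (k + 1) * F (k + 1) := by
        rw [← ENNReal.tsum_mul_left]
        exact tsum_congr fun k => by rw [h, mul_assoc]
    _ ≤ _ := by
        refine mul_le_mul_right ?_ _
        exact ENNReal.tsum_comp_le_tsum_of_injective (add_left_injective 1)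
          fun k => negBinomial hα 1 k * F k

theorem tsum_noise_add_le (F : ℤ → ℝ≥0∞) (s : ℕ) :
    ∑' z, noise hα 1 z * F (z + s) ≤ ENNReal.ofReal α⁻¹ ^ s * ∑' z, noise hα 1 z * F z := by
  induction s generalizing F with
  | zero => simp
  | succ s ih =>
    have h := ih fun z => F (z + 1)
    have h1 : ∀ z : ℤ, z + (s + 1 : ℕ) = z + s + 1 := fun z => by push_cast; ring
    simp only [h1]
    refine h.trans ?_
    rw [pow_succ, mul_assoc]
    gcongr
    simp only [tsum_noise_mul]
    have h2 : ∀ k l : ℕ, (k : ℤ) - l + 1 = ((k + 1 : ℕ) : ℤ) - l := fun k l => by push_cast; ring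
    simp only [h2]
    exact tsum_negBinomial_succ_le hα fun k => ∑' l, negBinomial hα 1 l * F ((k : ℤ) - l)

theorem tsum_noise_sub_le (F : ℤ → ℝ≥0∞) (s : ℕ) :
    ∑' z, noise hα 1 z * F (z - s) ≤ ENNReal.ofReal α⁻¹ ^ s * ∑' z, noise hα 1 z * F z := by
  induction s generalizing F with
  | zero => simp
  | succ s ih =>
    have h := ih fun z => F (z - 1)
    have h1 : ∀ z : ℤ, z - (s + 1 : ℕ) = z - s - 1 := fun z => by push_cast; ring
    simp only [h1]
    refine h.trans ?_
    rw [pow_succ, mul_assoc]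
    gcongr
    simp only [tsum_noise_mul]
    rw [← ENNReal.tsum_mul_left]
    have h2 : ∀ k l : ℕ, (k : ℤ) - l - 1 = (k : ℤ) - (l + 1 : ℕ) := fun k l => by push_cast; ring
    simp only [h2]
    refine ENNReal.tsum_le_tsum fun k => ?_
    rw [mul_left_comm]
    gcongr
    exact tsum_negBinomial_succ_le hα fun l => F ((k : ℤ) - l)

theorem tsum_noise_translate_le (F : ℤ → ℝ≥0∞) (t : ℤ) {n : ℕ} (ht : t.natAbs ≤ n) :
    ∑' z, noise hα 1 z * F (z + t) ≤ ENNReal.ofReal α⁻¹ ^ n * ∑' z, noise hα 1 z * F z := by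
  have h1 : 1 ≤ ENNReal.ofReal α⁻¹ :=
    ENNReal.one_le_ofReal.2 ((one_le_inv₀ hα.1).2 hα.2.le)
  refine le_trans ?_ (mul_le_mul_left (pow_le_pow_right₀ h1 ht) _)
  rcases Int.natAbs_eq t with h | h
  · nth_rewrite 1 [h]
    exact tsum_noise_add_le hα F _
  · nth_rewrite 1 [h]
    simp only [← sub_eq_add_neg]
    exact tsum_noise_sub_le hα F _

theorem tsum_negBinomial_sq_le :
    ∑' k, negBinomial hα 1 k * ENNReal.ofReal (2 * (k : ℝ) ^ 2) ≤
      ENNReal.ofReal (4 / (1 - α) ^ 2) := by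
  have h0 : 0 < 1 - α := sub_pos.2 hα.2
  have hα0 := hα.1
  have hnorm : ‖α‖ < 1 := by rw [Real.norm_of_nonneg hα0.le]; exact hα.2
  have hs := summable_choose_mul_geometric_of_norm_lt_one 2 hnorm
  have ht := tsum_choose_mul_geometric_of_norm_lt_one 2 hnorm
  -- Bound `2k²` by `4 * (k+2).choose 2`, whose generating function is `4 / (1 - α)^3`.
  have h1 : ∀ k, negBinomial hα 1 k * ENNReal.ofReal (2 * (k : ℝ) ^ 2) ≤
      ENNReal.ofReal (4 * (1 - α) * (((k + 2).choose 2 : ℕ) * α ^ k)) := fun k => by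
    rw [negBinomial_one_apply, ← ENNReal.ofReal_mul (by positivity)]
    refine ENNReal.ofReal_le_ofReal ?_
    rw [Nat.cast_choose_two]
    have : 0 ≤ (1 - α) * α ^ k := by positivity
    push_cast
    nlinarith [mul_nonneg this (Nat.cast_nonneg (α := ℝ) k)]
  refine (ENNReal.tsum_le_tsum h1).trans (le_of_eq ?_)
  rw [← ENNReal.ofReal_tsum_of_nonneg (fun k => by positivity) (hs.mul_left _), tsum_mul_left, ht]
  congr 1
  field_simp

theorem tsum_noise_sq_le :
    ∑' z, noise hα 1 z * ENNReal.ofReal ((z : ℝ) ^ 2) ≤ ENNReal.ofReal (8 / (1 - α) ^ 2) := by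
  rw [tsum_noise_mul]
  have h1 : ∀ k l : ℕ, ENNReal.ofReal ((((k : ℤ) - l : ℤ) : ℝ) ^ 2) ≤
      ENNReal.ofReal (2 * (k : ℝ) ^ 2) + ENNReal.ofReal (2 * (l : ℝ) ^ 2) := fun k l => by
    rw [← ENNReal.ofReal_add (by positivity) (by positivity)]
    refine ENNReal.ofReal_le_ofReal ?_
    push_cast
    nlinarith [sq_nonneg ((k : ℝ) + l)]
  calc _ ≤ ∑' k, negBinomial hα 1 k * ∑' l, negBinomial hα 1 l *
        (ENNReal.ofReal (2 * (k : ℝ) ^ 2) + ENNReal.ofReal (2 * (l : ℝ) ^ 2)) := by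
        gcongr with k l
        exact h1 k l
    _ = ∑' k, negBinomial hα 1 k * ENNReal.ofReal (2 * (k : ℝ) ^ 2) +
        ∑' l, negBinomial hα 1 l * ENNReal.ofReal (2 * (l : ℝ) ^ 2) := by
        simp only [mul_add, ENNReal.tsum_add, ENNReal.tsum_mul_right, PMF.tsum_coe, one_mul]
    _ ≤ ENNReal.ofReal (4 / (1 - α) ^ 2) + ENNReal.ofReal (4 / (1 - α) ^ 2) :=
        add_le_add (tsum_negBinomial_sq_le hα) (tsum_negBinomial_sq_le hα)
    _ = _ := by
        rw [← ENNReal.ofReal_add (by positivity) (by positivity)]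
        congr 1
        ring

/-- The noise distribution modulo `q`, as a real-valued probability mass function. -/
noncomputable def modNoise (q : ℕ) (r : ℝ≥0) (g : ZMod q) : ℝ :=
  ((noise hα r).map (Int.cast : ℤ → ZMod q) g).toReal

variable {q : ℕ}

theorem modNoise_nonneg (r : ℝ≥0) (g : ZMod q) : 0 ≤ modNoise hα q r g := ENNReal.toReal_nonneg

theorem ofReal_modNoise (r : ℝ≥0) (g : ZMod q) :
    ENNReal.ofReal (modNoise hα q r g) = (noise hα r).map (Int.cast : ℤ → ZMod q) g :=
  ENNReal.ofReal_toReal (PMF.apply_ne_top _ _)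

variable [NeZero q]

theorem sum_modNoise_mul (r : ℝ≥0) (F : ZMod q → ℝ) (hF : ∀ g, 0 ≤ F g) :
    ENNReal.ofReal (∑ g, modNoise hα q r g * F g) =
      ∑' z, noise hα r z * ENNReal.ofReal (F z) := by
  have h : ∑' z, noise hα r z * ENNReal.ofReal (F z) =
      ∑' g, (noise hα r).map (Int.cast : ℤ → ZMod q) g * ENNReal.ofReal (F g) := by
    rw [← PMF.bind_pure_comp, tsum_bind_mul]
    simp only [Function.comp_apply, tsum_pure_mul]
  rw [h, tsum_fintype, ENNReal.ofReal_sum_of_nonneg fun g _ =>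
    mul_nonneg (modNoise_nonneg hα r g) (hF g)]
  refine Finset.sum_congr rfl fun g _ => ?_
  rw [ENNReal.ofReal_mul (modNoise_nonneg hα r g), ofReal_modNoise]

theorem sum_modNoise (r : ℝ≥0) : ∑ g, modNoise hα q r g = 1 := by
  have h := sum_modNoise_mul hα (q := q) r (fun _ => 1) fun _ => zero_le_one
  simp only [mul_one, ENNReal.ofReal_one, PMF.tsum_coe] at h
  exact (ENNReal.ofReal_eq_one).1 h

theorem sum_modNoise_translate_le (F : ZMod q → ℝ) (hF : ∀ g, 0 ≤ F g) (t : ℤ) {n : ℕ}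
    (ht : t.natAbs ≤ n) :
    ∑ g, modNoise hα q 1 g * F (g + t) ≤ α⁻¹ ^ n * ∑ g, modNoise hα q 1 g * F g := by
  have hα0 := hα.1
  have h := tsum_noise_translate_le hα (fun z => ENNReal.ofReal (F z)) t ht
  simp only [Int.cast_add] at h
  rw [← sum_modNoise_mul hα 1 (fun g : ZMod q => F (g + t)) (fun g => hF _), ← sum_modNoise_mul hα 1 F hF,
    ← ENNReal.ofReal_pow (by positivity), ← ENNReal.ofReal_mul (by positivity)] at h
  refine (ENNReal.ofReal_le_ofReal_iff ?_).1 h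
  exact mul_nonneg (by positivity)
    (Finset.sum_nonneg fun g _ => mul_nonneg (modNoise_nonneg hα 1 g) (hF g))

theorem sum_modNoise_add (r s : ℝ≥0) (F : ZMod q → ℝ) (hF : ∀ g, 0 ≤ F g) :
    ∑ a, modNoise hα q r a * ∑ b, modNoise hα q s b * F (a + b) =
      ∑ g, modNoise hα q (r + s) g * F g := by
  have hn : ∀ (s : ℝ≥0) (F : ZMod q → ℝ), (∀ g, 0 ≤ F g) → 0 ≤ ∑ g, modNoise hα q s g * F g :=
    fun s F hF => Finset.sum_nonneg fun g _ => mul_nonneg (modNoise_nonneg hα s g) (hF g)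
  rw [← ENNReal.ofReal_eq_ofReal_iff (hn r _ fun a => hn s _ fun b => hF _) (hn _ _ hF),
    sum_modNoise_mul hα r _ fun a => hn s _ fun b => hF _, sum_modNoise_mul hα _ _ hF, noise_add]
  simp only [tsum_bind_mul, tsum_pure_mul, Int.cast_add]
  refine tsum_congr fun z => ?_
  rw [sum_modNoise_mul hα s _ fun b => hF _]

theorem sum_prod_modNoise (r : ℝ≥0) (n : ℕ) (F : ZMod q → ℝ) (hF : ∀ g, 0 ≤ F g) :
    ∑ w : Fin (n + 1) → ZMod q, (∏ i, modNoise hα q r (w i)) * F (∑ i, w i) =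
      ∑ g, modNoise hα q ((n + 1 : ℕ) * r) g * F g := by
  induction n generalizing F with
  | zero =>
    rw [← (Equiv.funUnique (Fin 1) (ZMod q)).symm.sum_comp]
    simp
  | succ n ih =>
    rw [← (Fin.consEquiv fun _ : Fin (n + 1 + 1) => ZMod q).sum_comp, Fintype.sum_prod_type,
      show ((n + 1 + 1 : ℕ) : ℝ≥0) * r = r + (n + 1 : ℕ) * r by push_cast; ring,
      ← sum_modNoise_add hα _ _ F hF]
    refine Finset.sum_congr rfl fun a _ => ?_
    rw [← ih (fun b => F (a + b)) fun b => hF _, Finset.mul_sum]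
    refine Finset.sum_congr rfl fun w _ => ?_
    simp only [Fin.prod_univ_succ (n := n + 1), Fin.sum_univ_succ (n := n + 1),
      Fin.consEquiv_apply, Fin.cons_zero, Fin.cons_succ, mul_assoc]

end Noise

end ShuffleModel

namespace ShuffleModel

open Finset

/-! ### The law of the view and its indistinguishability -/

section ViewMass

variable {q n M : ℕ}

/-- The probability mass function of the view of the data collector when user `i` splits the
residue `a i`, blurred by noise with mass function `D`, into uniformly random shares. -/
noncomputable def viewMass (D : ZMod q → ℝ) (a : Fin n → ZMod q)
    (v : Fin (M + 1) → Fin n → ZMod q) : ℝ :=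
  (∑ s : Fin (M + 1) → Equiv.Perm (Fin n),
    ∏ i, D ((∑ j, v j (s j i)) - a i) / (q : ℝ) ^ M) / n.factorial ^ (M + 1)

theorem viewMass_nonneg {D : ZMod q → ℝ} (hD0 : ∀ g, 0 ≤ D g) (a : Fin n → ZMod q)
    (v : Fin (M + 1) → Fin n → ZMod q) :
    0 ≤ viewMass D a v := by
  unfold viewMass
  exact div_nonneg (sum_nonneg fun s _ => prod_nonneg fun i _ =>
    div_nonneg (hD0 _) (by positivity)) (by positivity)

variable [NeZero q]

theorem sum_hitProb_left (y : Fin n → ZMod q) :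
    ∑ v : Fin (M + 1) → Fin n → ZMod q, hitProb v y = (q : ℝ) ^ (n * M) := by
  unfold hitProb
  rw [← sum_div, sum_comm]
  have h : ∀ s : Fin (M + 1) → Equiv.Perm (Fin n), ∑ v : Fin (M + 1) → Fin n → ZMod q,
      (if ∑ j, v j ∘ s j = y then (1 : ℝ) else 0) = (q : ℝ) ^ (n * M) := by
    intro s
    refine (Equiv.sum_comp (Equiv.piCongrRight fun j =>
        (s j).symm.arrowCongr (Equiv.refl (ZMod q))) (fun v : Fin (M + 1) → Fin n → ZMod q =>
        if ∑ j, v j = y then (1 : ℝ) else 0)).trans ?_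
    rw [sum_apply_sum M fun u : Fin n → ZMod q => if u = y then (1 : ℝ) else 0]
    simp [pow_mul]
  simp only [h]
  rw [sum_const, card_univ, nsmul_eq_mul, card_perm_pi]
  field_simp

theorem viewMass_eq (D : ZMod q → ℝ) (a : Fin n → ZMod q) (v : Fin (M + 1) → Fin n → ZMod q) :
    viewMass D a v = ∑ y, (∏ i, D (y i - a i)) * (hitProb v y / (q : ℝ) ^ (n * M)) := by
  have h : ∀ s : Fin (M + 1) → Equiv.Perm (Fin n),
      ∏ i, D ((∑ j, v j (s j i)) - a i) / (q : ℝ) ^ M =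
      ∑ y : Fin n → ZMod q, (∏ i, D (y i - a i)) / (q : ℝ) ^ (n * M) *
        if ∑ j, v j ∘ s j = y then 1 else 0 := by
    intro s
    simp only [mul_ite, mul_one, mul_zero]
    rw [sum_ite_eq, if_pos (mem_univ _), prod_div_distrib]
    simp [pow_mul, pow_right_comm]
  simp only [viewMass, h, hitProb]
  rw [sum_comm, sum_div]
  refine sum_congr rfl fun y _ => ?_
  rw [← mul_sum]
  ring

theorem sum_mul_viewMass (D : ZMod q → ℝ) (a : Fin n → ZMod q)
    (χ : (Fin (M + 1) → Fin n → ZMod q) → ℝ) :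
    ∑ v, χ v * viewMass D a v =
      ∑ y, (∏ i, D (y i - a i)) * ((∑ v, χ v * hitProb v y) / (q : ℝ) ^ (n * M)) := by
  simp only [viewMass_eq, mul_sum, sum_div]
  rw [sum_comm]
  exact sum_congr rfl fun y _ => sum_congr rfl fun v _ => by ring

theorem sum_prod_sub (D F : ZMod q → ℝ) (a : Fin n → ZMod q) :
    ∑ y : Fin n → ZMod q, (∏ i, D (y i - a i)) * F (∑ i, y i) =
      ∑ w : Fin n → ZMod q, (∏ i, D (w i)) * F (∑ i, w i + ∑ i, a i) := by
  rw [← Equiv.sum_comp (Equiv.addRight a)]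
  simp [sum_add_distrib]

theorem sum_viewMass_mul (D H : ZMod q → ℝ) (a : Fin n → ZMod q) :
    ∑ v : Fin (M + 1) → Fin n → ZMod q, H (∑ j, ∑ i, v j i) * viewMass D a v =
      ∑ w : Fin n → ZMod q, (∏ i, D (w i)) * H (∑ i, w i + ∑ i, a i) := by
  have hq : (0 : ℝ) < q := by exact_mod_cast Nat.pos_of_ne_zero (NeZero.ne q)
  rw [sum_mul_viewMass, ← sum_prod_sub]
  refine sum_congr rfl fun y _ => ?_
  have h : ∀ v : Fin (M + 1) → Fin n → ZMod q,
      H (∑ j, ∑ i, v j i) * hitProb v y = H (∑ i, y i) * hitProb v y := by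
    intro v
    rw [← hitProb_mul_sameSum]
    unfold sameSum
    split_ifs with h
    · rw [h]
    · simp
  simp only [h]
  rw [← mul_sum, sum_hitProb_left, mul_div_cancel_right₀ _ (by positivity)]

variable {α : ℝ} (hα : α ∈ Set.Ioo (0 : ℝ) 1)

/-- Replace each view by an ideal one that depends on the residues only through their noisy total,
at cost `γ`. The ideal views are compared by translating the aggregate noise by `t`; the replacement
for `a'` is scaled by `exp ε`, hence the factor `1 + exp ε`. -/
theorem viewMass_indistinguishable {k h : ℕ} {γ ε : ℝ} (hγ0 : 0 ≤ γ) (hγ1 : γ ≤ 1)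
    (hγ : q * ((k + 1 : ℕ) : ℝ) ^ 2 * (((k + 1 : ℕ) : ℝ) ^ h)⁻¹ ≤ γ ^ 2)
    (hε : α⁻¹ ^ (k + 1) = Real.exp ε) {r : NNReal} (hr : ((k + 1 : ℕ) : NNReal) * r = 1)
    (a a' : Fin (k + 1) → ZMod q) (t : ℤ) (ht : t.natAbs ≤ k + 1)
    (hat : ∑ i, a i = t + ∑ i, a' i)
    (χ : (Fin (2 * h + 1 + 1) → Fin (k + 1) → ZMod q) → ℝ) (hχ0 : ∀ v, 0 ≤ χ v)
    (hχ1 : ∀ v, χ v ≤ 1) :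
    ∑ v, χ v * viewMass (modNoise hα q r) a v -
      Real.exp ε * ∑ v, χ v * viewMass (modNoise hα q r) a' v ≤ (1 + Real.exp ε) * γ := by
  have hq : (0 : ℝ) < q := by exact_mod_cast Nat.pos_of_ne_zero (NeZero.ne q)
  set D := modNoise hα q r with hD
  have hD0 : ∀ g, 0 ≤ D g := modNoise_nonneg hα r
  set Qm : ℝ := (q : ℝ) ^ ((k + 1) * (2 * h + 1)) with hQm
  have hQ0 : 0 < Qm := by positivity
  -- `J g` is the expectation of the test `χ` over a message matrix uniform among those with total
  -- `g`.
  set J : ZMod q → ℝ := fun g => (∑ v : Fin (2 * h + 1 + 1) → Fin (k + 1) → ZMod q,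
    χ v * ((if ∑ j, ∑ i, v j i = g then 1 else 0) * ((q : ℝ) ^ k)⁻¹)) / Qm with hJ
  have hJ0 : ∀ g, 0 ≤ J g := fun g => by
    refine div_nonneg (sum_nonneg fun v _ => mul_nonneg (hχ0 v) ?_) hQ0.le
    split_ifs <;> positivity
  have hclose : ∀ y : Fin (k + 1) → ZMod q,
      |(∑ v, χ v * hitProb v y) / Qm - J (∑ i, y i)| ≤ γ := by
    intro y
    rw [hJ, ← sub_div, abs_div, abs_of_pos hQ0, div_le_iff₀ hQ0, ← sum_sub_distrib, mul_comm γ]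
    refine (abs_sum_le_sum_abs _ _).trans ((sum_le_sum fun v _ => ?_).trans
      (sum_abs_hitProb_sub_le hγ0 hγ1 hγ y))
    rw [← mul_sub, abs_mul, abs_of_nonneg (hχ0 v)]
    exact mul_le_of_le_one_left (abs_nonneg _) (hχ1 v)
  have hW : ∀ b : Fin (k + 1) → ZMod q, ∑ y : Fin (k + 1) → ZMod q, ∏ i, D (y i - b i) = 1 := by
    intro b
    have h1 := sum_prod_sub D (fun _ => 1) b
    simp only [mul_one] at h1
    have h2 := sum_prod_modNoise hα (q := q) r k (fun _ => 1) fun _ => zero_le_one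
    simp only [mul_one, sum_modNoise] at h2
    rw [h1, h2]
  have hideal : ∀ b : Fin (k + 1) → ZMod q,
      ∑ y : Fin (k + 1) → ZMod q, (∏ i, D (y i - b i)) * J (∑ i, y i) =
      ∑ g, modNoise hα q 1 g * J (g + ∑ i, b i) := by
    intro b
    rw [sum_prod_sub, sum_prod_modNoise hα r k (fun g => J (g + ∑ i, b i)) fun g => hJ0 _, hr]
  have hdiff : ∀ b : Fin (k + 1) → ZMod q, |∑ v, χ v * viewMass D b v -
      ∑ g, modNoise hα q 1 g * J (g + ∑ i, b i)| ≤ γ := by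
    intro b
    rw [sum_mul_viewMass, ← hideal, ← sum_sub_distrib]
    calc _ ≤ ∑ y : Fin (k + 1) → ZMod q, (∏ i, D (y i - b i)) * γ := by
          refine (abs_sum_le_sum_abs _ _).trans (sum_le_sum fun y _ => ?_)
          rw [← mul_sub, abs_mul, abs_of_nonneg (prod_nonneg fun i _ => hD0 _)]
          exact mul_le_mul_of_nonneg_left (hclose y) (prod_nonneg fun i _ => hD0 _)
      _ = γ := by rw [← sum_mul, hW, one_mul]
  have hshift := sum_modNoise_translate_le hα (fun g => J (g + ∑ i, a' i)) (fun g => hJ0 _) t ht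
  simp only [add_assoc, ← hat, hε] at hshift
  have h1 := (abs_le.1 (hdiff a)).2
  have h2 := mul_le_mul_of_nonneg_left (abs_le.1 (hdiff a')).1 (Real.exp_pos ε).le
  linarith

end ViewMass

/-! ### The protocol, its view and its privacy -/

section SplitProtocol

variable {q : ℕ} [NeZero q] {M : ℕ} {Y : Type*} [Fintype Y] (e : Y ≃ ZMod q)

/-- The law of uniformly random shares of a residue `a` that is blurred by noise with mass
function `D`. -/
noncomputable def shares {D : ZMod q → ℝ} (hD0 : ∀ g, 0 ≤ D g) (hD1 : ∑ g, D g = 1)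
    (a : ZMod q) : PMF (Fin (M + 1) → Y) :=
  PMF.ofFintype (fun y => ENNReal.ofReal (D (∑ j, e (y j) - a) / (q : ℝ) ^ M)) (by
    have hq : (0 : ℝ) < q := by exact_mod_cast Nat.pos_of_ne_zero (NeZero.ne q)
    have h : ∑ y : Fin (M + 1) → Y, D (∑ j, e (y j) - a) =
        ∑ u : Fin (M + 1) → ZMod q, D (∑ j, u j - a) :=
      Equiv.sum_comp (Equiv.piCongrRight fun _ : Fin (M + 1) => e) fun u => D (∑ j, u j - a)
    rw [← ENNReal.ofReal_sum_of_nonneg fun y _ => div_nonneg (hD0 _) (by positivity),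
      ENNReal.ofReal_eq_one, ← sum_div, h, sum_apply_sum M fun g => D (g - a),
      show ∑ g, D (g - a) = 1 from (Equiv.sum_comp (Equiv.subRight a) D).trans hD1, ZMod.card, mul_one]
    exact div_self (by positivity))

variable [MeasurableSpace Y] [MeasurableSingletonClass Y] {n : ℕ}

/-- Every user rounds `n * x` down to an integer and sends uniformly random shares of the noisy
integer modulo `q`; the analyzer adds up all the messages. -/
noncomputable def splitProtocol {D : ZMod q → ℝ} (hD0 : ∀ g, 0 ≤ D g) (hD1 : ∑ g, D g = 1)
    (n M : ℕ) : Protocol (Set.Icc (0 : ℝ) 1) Y ℝ n (M + 1) where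
  randomizer := (Kernel.ofFunOfCountable fun a : ℕ =>
    (shares (M := M) e hD0 hD1 (a : ZMod q)).toMeasure).comap
      (fun x : Set.Icc (0 : ℝ) 1 => ⌊n * (x : ℝ)⌋₊) (by fun_prop)
  analyzer := Kernel.deterministic
    (fun v => ((∑ j, ∑ i, e (v j i)).valMinAbs : ℝ) / n) (measurable_of_finite _)
  markov_randomizer := ⟨fun x => by
    rw [Kernel.comap_apply]
    exact PMF.toMeasure.isProbabilityMeasure _⟩
  markov_analyzer := inferInstance

variable {D : ZMod q → ℝ} (hD0 : ∀ g, 0 ≤ D g) (hD1 : ∑ g, D g = 1)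

theorem view_splitProtocol_singleton (x : Fin n → Set.Icc (0 : ℝ) 1)
    (v : Fin (M + 1) → Fin n → Y) :
    ((splitProtocol e hD0 hD1 n M).view x) {v} =
      ENNReal.ofReal (viewMass D (fun i => (⌊n * (x i : ℝ)⌋₊ : ZMod q)) fun j i => e (v j i)) := by
  have hq : (0 : ℝ) < q := by exact_mod_cast Nat.pos_of_ne_zero (NeZero.ne q)
  have h1 : ∀ π : Fin (M + 1) → Equiv.Perm (Fin n),
      ((splitProtocol e hD0 hD1 n M).messages x).map (shuffle π) {v} =
      ENNReal.ofReal (∏ i, D ((∑ j, e (v j ((π j)⁻¹ i))) - (⌊n * (x i : ℝ)⌋₊ : ZMod q)) /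
        (q : ℝ) ^ M) := by
    intro π
    rw [Measure.map_apply (measurable_shuffle π) (measurableSet_singleton v)]
    have h2 : (shuffle π : (Fin n → Fin (M + 1) → Y) → _) ⁻¹' {v} =
        {fun i j => v j ((π j)⁻¹ i)} := by
      ext y
      simp only [Set.mem_preimage, Set.mem_singleton_iff, funext_iff, shuffle]
      constructor
      · intro h i j
        rw [← h j]
        simp
      · intro h j i
        rw [h]
        simp
    have := (splitProtocol e hD0 hD1 n M).markov_randomizer
    rw [h2, Protocol.messages, Measure.pi_singleton,
      ENNReal.ofReal_prod_of_nonneg fun i _ => div_nonneg (hD0 _) (by positivity)]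
    refine prod_congr rfl fun i _ => ?_
    change (shares e hD0 hD1 (⌊n * (x i : ℝ)⌋₊ : ZMod q)).toMeasure _ = _
    rw [PMF.toMeasure_apply_singleton _ _ (measurableSet_singleton _)]
    rfl
  have hf : (0 : ℝ) < (n.factorial : ℝ) ^ (M + 1) := by positivity
  simp only [Protocol.view, Measure.smul_apply, Measure.finsetSum_apply, h1, smul_eq_mul]
  rw [← ENNReal.ofReal_sum_of_nonneg fun π _ => prod_nonneg fun i _ =>
      div_nonneg (hD0 _) (by positivity), ← ENNReal.ofReal_natCast, card_perm_pi,
    ← ENNReal.ofReal_inv_of_pos hf, ← ENNReal.ofReal_mul (by positivity), viewMass, div_eq_inv_mul]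
  congr 2
  -- The preimage under the shuffle involves the inverse permutations; the uniform average over the
  -- group does not see the inversion.
  exact Equiv.sum_comp (Equiv.inv (Fin (M + 1) → Equiv.Perm (Fin n)))
    fun s => ∏ i, D ((∑ j, e (v j (s j i))) - (⌊n * (x i : ℝ)⌋₊ : ZMod q)) / (q : ℝ) ^ M

open Classical in
theorem view_splitProtocol_real (x : Fin n → Set.Icc (0 : ℝ) 1)
    (E : Set (Fin (M + 1) → Fin n → Y)) :
    ((splitProtocol e hD0 hD1 n M).view x).real E =
      ∑ v, (if (fun j i => e.symm (v j i)) ∈ E then 1 else 0) *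
        viewMass D (fun i => (⌊n * (x i : ℝ)⌋₊ : ZMod q)) v := by
  have := (splitProtocol e hD0 hD1 n M).isProbabilityMeasure_view x
  have h1 : ((splitProtocol e hD0 hD1 n M).view x).real E =
      ∑ v, if v ∈ E then ((splitProtocol e hD0 hD1 n M).view x).real {v} else 0 := by
    rw [← sum_filter, sum_measureReal_singleton]
    congr 1
    ext v
    simp
  rw [h1, ← Equiv.sum_comp (Equiv.piCongrRight fun _ => Equiv.piCongrRight fun _ => e.symm)]
  refine sum_congr rfl fun v _ => ?_
  simp only [measureReal_def, view_splitProtocol_singleton,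
    ENNReal.toReal_ofReal (viewMass_nonneg hD0 _ _)]
  change (if (fun j i => e.symm (v j i)) ∈ E then viewMass D _ (fun j i => e (e.symm (v j i))) else 0)
    = _
  simp

theorem lintegral_mechanism_splitProtocol (x : Fin n → Set.Icc (0 : ℝ) 1) {H : ℝ → ℝ}
    (hH : Measurable H) (hH0 : ∀ z, 0 ≤ H z) :
    ∫⁻ z, ENNReal.ofReal (H z) ∂((splitProtocol e hD0 hD1 n M).mechanism x) =
      ENNReal.ofReal (∑ w : Fin n → ZMod q, (∏ i, D (w i)) *
        H (((∑ i, w i + ∑ i, (⌊n * (x i : ℝ)⌋₊ : ZMod q)).valMinAbs : ℝ) / n)) := by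
  have hm : (splitProtocol e hD0 hD1 n M).mechanism x =
      ((splitProtocol e hD0 hD1 n M).view x).map
        (fun v => ((∑ j, ∑ i, e (v j i)).valMinAbs : ℝ) / n) :=
    Measure.deterministic_comp_eq_map (measurable_of_finite _)
  rw [hm, lintegral_map (by fun_prop) (measurable_of_finite _), lintegral_fintype,
    ← sum_viewMass_mul D (fun g => H ((g.valMinAbs : ℝ) / n)),
    ENNReal.ofReal_sum_of_nonneg fun v _ => mul_nonneg (hH0 _) (viewMass_nonneg hD0 _ _),
    ← Equiv.sum_comp (Equiv.piCongrRight fun _ => Equiv.piCongrRight fun _ => e)]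
  refine sum_congr rfl fun v _ => ?_
  rw [view_splitProtocol_singleton, ENNReal.ofReal_mul (hH0 _)]
  rfl

theorem isDP_splitProtocol {α : ℝ} (hα : α ∈ Set.Ioo (0 : ℝ) 1) {k h : ℕ} {γ ε δ : ℝ}
    (hγ0 : 0 ≤ γ) (hγ1 : γ ≤ 1)
    (hγ : q * ((k + 1 : ℕ) : ℝ) ^ 2 * (((k + 1 : ℕ) : ℝ) ^ h)⁻¹ ≤ γ ^ 2)
    (hε : α⁻¹ ^ (k + 1) = Real.exp ε) {r : NNReal} (hr : ((k + 1 : ℕ) : NNReal) * r = 1)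
    (hδ : (1 + Real.exp ε) * γ ≤ δ) :
    (splitProtocol e (modNoise_nonneg hα r) (sum_modNoise hα r) (k + 1) (2 * h + 1)).IsDP ε δ := by
  classical
  rintro x x' ⟨i, hi⟩ E -
  rw [view_splitProtocol_real, view_splitProtocol_real]
  refine (viewMass_indistinguishable hα hγ0 hγ1 hγ hε hr _ _
    ((⌊((k + 1 : ℕ) : ℝ) * (x i : ℝ)⌋₊ : ℤ) - (⌊((k + 1 : ℕ) : ℝ) * (x' i : ℝ)⌋₊ : ℤ)) ?_ ?_ _
    (fun v => by split_ifs <;> simp) (fun v => by split_ifs <;> simp)).trans hδ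
  · have hb : ∀ u : Set.Icc (0 : ℝ) 1, ⌊((k + 1 : ℕ) : ℝ) * (u : ℝ)⌋₊ ≤ k + 1 := fun u =>
      Nat.floor_le_of_le (mul_le_of_le_one_right (Nat.cast_nonneg _) u.2.2)
    have := hb (x i)
    have := hb (x' i)
    omega
  · rw [← add_sum_erase _ _ (mem_univ i), ← add_sum_erase univ (fun j =>
      (⌊((k + 1 : ℕ) : ℝ) * (x' j : ℝ)⌋₊ : ZMod q)) (mem_univ i)]
    rw [sum_congr rfl fun j hj => by rw [hi j (ne_of_mem_erase hj)]]
    push_cast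
    ring

end SplitProtocol

/-! ### Mean squared error -/

section Accuracy

/-- Without wrap-around the error is `|z|`. Wrap-around forces `|z| ≥ q/4` because `S ≤ q/4`, while
the decoded value lies within `3q/4` of `S`. -/
theorem abs_valMinAbs_add_sub_le {q : ℕ} [NeZero q] (S : ℕ) (hS : 4 * S ≤ q) (z : ℤ) :
    |((z : ZMod q) + (S : ZMod q)).valMinAbs - (S : ℤ)| ≤ 3 * |z| := by
  have hr := ZMod.valMinAbs_mem_Ioc ((z : ZMod q) + (S : ZMod q))
  rw [Set.mem_Ioc] at hr
  by_cases h : -(q : ℤ) < (z + S) * 2 ∧ (z + S) * 2 ≤ q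
  · have h1 : ((z : ZMod q) + (S : ZMod q)).valMinAbs = z + S :=
      (ZMod.valMinAbs_spec _ _).2 ⟨by push_cast; rfl, h.1, h.2⟩
    rw [h1, add_sub_cancel_right]
    have := abs_nonneg z
    linarith
  · rw [abs_le]
    rcases abs_cases z with ⟨h1, h2⟩ | ⟨h1, h2⟩ <;> omega

variable {q : ℕ} [NeZero q] {Y : Type*} [Fintype Y] (e : Y ≃ ZMod q) [MeasurableSpace Y]
  [MeasurableSingletonClass Y]

theorem mse_splitProtocol_le {α : ℝ} (hα : α ∈ Set.Ioo (0 : ℝ) 1) {k M : ℕ}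
    (hq : 4 * (k + 1) ^ 2 ≤ q) {r : NNReal} (hr : ((k + 1 : ℕ) : NNReal) * r = 1) :
    (splitProtocol e (modNoise_nonneg hα r) (sum_modNoise hα r) (k + 1) M).MSE ≤
      ENNReal.ofReal (144 / (((k + 1 : ℕ) : ℝ) * (1 - α)) ^ 2 + 2) := by
  refine iSup_le fun x => ?_
  have h0 : 0 < 1 - α := sub_pos.2 hα.2
  rw [lintegral_mechanism_splitProtocol e (modNoise_nonneg hα r) (sum_modNoise hα r) x
    (H := fun z => (z - ∑ i, (x i : ℝ)) ^ 2) (by fun_prop) (fun z => sq_nonneg _),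
    sum_prod_modNoise hα r k (fun g : ZMod q =>
      (((g + ∑ i, (⌊((k + 1 : ℕ) : ℝ) * (x i : ℝ)⌋₊ : ZMod q)).valMinAbs : ℝ) / ((k + 1 : ℕ) : ℝ) -
      ∑ i, (x i : ℝ)) ^ 2) (fun g => sq_nonneg _), hr,
    sum_modNoise_mul hα 1 _ (fun g => sq_nonneg _)]
  set n : ℝ := ((k + 1 : ℕ) : ℝ) with hn
  have hn0 : 0 < n := by positivity
  set S : ℕ := ∑ i, ⌊n * (x i : ℝ)⌋₊ with hSdef
  set X : ℝ := ∑ i, (x i : ℝ) with hX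
  have hS : 4 * S ≤ q := by
    have h1 : S ≤ ∑ i : Fin (k + 1), (k + 1) := sum_le_sum fun i _ =>
      Nat.floor_le_of_le (mul_le_of_le_one_right (Nat.cast_nonneg _) (x i).2.2)
    simp only [sum_const, card_univ, Fintype.card_fin, smul_eq_mul] at h1
    nlinarith
  have hSX : (S : ℝ) ≤ n * X ∧ n * X ≤ S + n := by
    rw [hSdef, hX, mul_sum]
    push_cast
    constructor
    · exact sum_le_sum fun i _ => Nat.floor_le (mul_nonneg hn0.le (x i).2.1)
    · calc _ ≤ ∑ i : Fin (k + 1), ((⌊n * (x i : ℝ)⌋₊ : ℝ) + 1) :=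
          sum_le_sum fun i _ => (Nat.lt_floor_add_one _).le
        _ = _ := by rw [sum_add_distrib]; simp [hn]
  have hz : ∀ z : ℤ, ((((z : ZMod q) + ∑ i, (⌊n * (x i : ℝ)⌋₊ : ZMod q)).valMinAbs : ℝ) / n -
      X) ^ 2 ≤ 18 / n ^ 2 * (z : ℝ) ^ 2 + 2 := by
    intro z
    rw [← Nat.cast_sum, ← hSdef]
    have h1 : |(((z : ZMod q) + (S : ZMod q)).valMinAbs : ℝ) - S| ≤ 3 * |(z : ℝ)| := by
      exact_mod_cast abs_valMinAbs_add_sub_le S hS z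
    set R : ℝ := (((z : ZMod q) + (S : ZMod q)).valMinAbs : ℝ) with hR
    -- The noise error is at most `3|z|` and the rounding error at most `n`, so `(a+b)² ≤ 2a² + 2b²`
    -- gives `18 = 2 * 9` and `2`.
    have h2 : (R - n * X) ^ 2 ≤ 18 * (z : ℝ) ^ 2 + 2 * n ^ 2 := by
      have h3 : (R - S) ^ 2 ≤ 9 * (z : ℝ) ^ 2 := by
        rw [← sq_abs, ← sq_abs (z : ℝ)]
        nlinarith [abs_nonneg (R - S)]
      have h4 : (S - n * X) ^ 2 ≤ n ^ 2 := by nlinarith [hSX.1, hSX.2]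
      nlinarith [sq_nonneg ((R - S) - (S - n * X))]
    rw [div_sub' hn0.ne', div_pow, div_mul_eq_mul_div, div_add' _ _ _ (by positivity)]
    exact div_le_div_of_nonneg_right h2 (by positivity)
  calc _ ≤ ∑' z, noise hα 1 z * (ENNReal.ofReal (18 / n ^ 2) * ENNReal.ofReal ((z : ℝ) ^ 2) +
        ENNReal.ofReal 2) := by
        refine ENNReal.tsum_le_tsum fun z => ?_
        rw [← ENNReal.ofReal_mul (by positivity), ← ENNReal.ofReal_add (by positivity) (by norm_num)]
        exact mul_le_mul_right (ENNReal.ofReal_le_ofReal (hz z)) _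
    _ = ENNReal.ofReal (18 / n ^ 2) * (∑' z, noise hα 1 z * ENNReal.ofReal ((z : ℝ) ^ 2)) +
        ENNReal.ofReal 2 := by
        simp only [mul_add, ENNReal.tsum_add, ENNReal.tsum_mul_right, PMF.tsum_coe, one_mul,
          mul_left_comm, ENNReal.tsum_mul_left]
    _ ≤ ENNReal.ofReal (18 / n ^ 2) * ENNReal.ofReal (8 / (1 - α) ^ 2) + ENNReal.ofReal 2 := by
        gcongr
        exact tsum_noise_sq_le hα
    _ = _ := by
        rw [← ENNReal.ofReal_mul (by positivity), ← ENNReal.ofReal_add (by positivity) (by norm_num)]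
        congr 2
        field_simp
        norm_num

end Accuracy

end ShuffleModel

namespace ShuffleModel

/-! ### Choice of parameters -/

section Parameters

theorem exists_bits {n : ℕ} (hn : 2 ≤ n) :
    ∃ b : ℕ, 4 * n ^ 2 ≤ 2 ^ b ∧ 2 ^ b ≤ n ^ 6 ∧ (b : ℝ) ≤ 9 * Real.log n := by
  have h1 : n ≤ 2 ^ Nat.clog 2 n := Nat.le_pow_clog one_lt_two n
  have h2 : 2 ^ Nat.clog 2 n ≤ 2 * n := by
    have h3 := Nat.pow_pred_clog_lt_self one_lt_two hn
    have h4 : 0 < Nat.clog 2 n := Nat.clog_pos one_lt_two hn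
    calc 2 ^ Nat.clog 2 n = 2 * 2 ^ (Nat.clog 2 n).pred := by
          rw [← pow_succ', Nat.pred_eq_sub_one, Nat.sub_add_cancel h4]
      _ ≤ 2 * n := Nat.mul_le_mul_left 2 h3.le
  set c := Nat.clog 2 n
  -- With `n ≤ 2^c ≤ 2n`, the choice `b = 2c + 2` puts `2^b` between `4n²` and `16n²`, and `16 ≤
  -- n^4`.
  have hb : 2 ^ (2 * c + 2) = 4 * (2 ^ c) ^ 2 := by ring
  refine ⟨2 * c + 2, ?_, ?_, ?_⟩
  · rw [hb]
    exact Nat.mul_le_mul_left _ (Nat.pow_le_pow_left h1 2)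
  · rw [hb]
    calc 4 * (2 ^ c) ^ 2 ≤ 4 * (2 * n) ^ 2 := Nat.mul_le_mul_left _ (Nat.pow_le_pow_left h2 2)
      _ = 2 ^ 4 * n ^ 2 := by ring
      _ ≤ n ^ 4 * n ^ 2 := Nat.mul_le_mul_right _ (Nat.pow_le_pow_left hn 4)
      _ = n ^ 6 := by ring
  · have hn' : (2 : ℝ) ≤ n := by exact_mod_cast hn
    have h3 : (c : ℝ) * Real.log 2 ≤ Real.log 2 + Real.log n := by
      rw [← Real.log_pow, ← Real.log_mul (by norm_num) (by positivity)]
      exact Real.log_le_log (by positivity) (by exact_mod_cast h2)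
    have h4 : Real.log 2 ≤ Real.log n := Real.log_le_log (by norm_num) hn'
    have h5 := Real.log_two_gt_d9
    push_cast
    nlinarith [Nat.cast_nonneg (α := ℝ) c]

/-- The part `n^8` of the power absorbs `q * n²`. The part `n^j ≥ 2^j` supplies `exp (2T)`, since `j
≥ 4T` and `log 2 > 1/2`. -/
theorem modulus_bound {n q : ℕ} (hn : 2 ≤ n) (hq : q ≤ n ^ 6) {T : ℝ} (j : ℕ) (hj : 4 * T ≤ j) :
    (q : ℝ) * (n : ℝ) ^ 2 * ((n : ℝ) ^ (8 + j))⁻¹ ≤ Real.exp (-T) ^ 2 := by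
  have hn' : (2 : ℝ) ≤ n := by exact_mod_cast hn
  have hq' : (q : ℝ) ≤ (n : ℝ) ^ 6 := by exact_mod_cast hq
  have h1 : Real.exp T ^ 2 ≤ (n : ℝ) ^ j := by
    have h2 : Real.exp T ^ 2 ≤ 2 ^ j := by
      rw [← Real.exp_log (show (0 : ℝ) < 2 ^ j by positivity), Real.log_pow, ← Real.exp_nat_mul]
      refine Real.exp_le_exp.2 ?_
      have := Real.log_two_gt_d9
      push_cast
      nlinarith [Nat.cast_nonneg (α := ℝ) j]
    exact h2.trans (pow_le_pow_left₀ (by norm_num) hn' j)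
  calc (q : ℝ) * (n : ℝ) ^ 2 * ((n : ℝ) ^ (8 + j))⁻¹
      ≤ (n : ℝ) ^ 6 * (n : ℝ) ^ 2 * ((n : ℝ) ^ (8 + j))⁻¹ := by gcongr
    _ = ((n : ℝ) ^ j)⁻¹ := by
        rw [pow_add]
        field_simp
    _ ≤ (Real.exp T ^ 2)⁻¹ := inv_anti₀ (by positivity) h1
    _ = _ := by rw [Real.exp_neg, inv_pow]

theorem noise_scale_bound {n ε ε₀ : ℝ} (hn : 1 ≤ n) (hε : 0 < ε) (hε₀ : ε ≤ ε₀) :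
    144 / (n * (1 - Real.exp (-(ε / n)))) ^ 2 + 2 ≤
      (144 * (1 + ε₀) ^ 2 + 2 * ε₀ ^ 2 + 9) / ε ^ 2 := by
  have hn0 : 0 < n := by linarith
  have ht : 0 < ε / n := by positivity
  have htε : ε / n ≤ ε₀ := (div_le_self hε.le hn).trans hε₀
  -- This is `1 - exp (-t) ≥ t / (1 + t)` at `t = ε / n ≤ ε₀`.
  have h1 : ε / (1 + ε₀) ≤ n * (1 - Real.exp (-(ε / n))) := by
    have h2 : Real.exp (-(ε / n)) ≤ (1 + ε / n)⁻¹ := by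
      rw [Real.exp_neg]
      exact inv_anti₀ (by positivity) (by linarith [Real.add_one_le_exp (ε / n)])
    calc ε / (1 + ε₀) ≤ ε / (1 + ε / n) := by gcongr
      _ = n * (1 - (1 + ε / n)⁻¹) := by field_simp; ring
      _ ≤ _ := by gcongr
  have hε₀' : 0 < ε₀ := hε.trans_le hε₀
  calc 144 / (n * (1 - Real.exp (-(ε / n)))) ^ 2 + 2
      ≤ 144 / (ε / (1 + ε₀)) ^ 2 + 2 * (ε₀ ^ 2 / ε ^ 2) := by
        have h3 : 1 ≤ ε₀ ^ 2 / ε ^ 2 := by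
          rw [one_le_div (by positivity)]
          gcongr
        gcongr
        linarith
    _ = (144 * (1 + ε₀) ^ 2 + 2 * ε₀ ^ 2) / ε ^ 2 := by field_simp
    _ ≤ _ := div_le_div_of_nonneg_right (by linarith) (by positivity)

end Parameters

end ShuffleModel

/-- Messages of `b` bits are elements of `Fin b → Bool`. -/
theorem mainTheorem1 :
    ∀ ε₀ : ℝ, 0 < ε₀ → ∃ C : ℝ, 0 < C ∧
      ∀ δ₀ : ℝ, 0 < δ₀ → δ₀ < 1 → ∃ K : ℝ, 0 < K ∧
        ∀ ε : ℝ, 0 < ε → ε ≤ ε₀ → ∀ δ : ℝ, 0 < δ → δ ≤ δ₀ → ∀ n : ℕ, 2 ≤ n →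
          ∃ (m b : ℕ) (P : ShuffleModel.Protocol (Set.Icc (0 : ℝ) 1) (Fin b → Bool) ℝ n m),
            P.IsDP ε δ ∧
            P.MSE ≤ ENNReal.ofReal (C / ε ^ 2) ∧
            1 ≤ m ∧
            (m : ℝ) ≤ K * Real.log (1 / δ) ∧
            (b : ℝ) ≤ C * Real.log n := by
  intro ε₀ hε₀
  -- The first two terms serve the error bound; the 9 serves the bit length.
  refine ⟨144 * (1 + ε₀) ^ 2 + 2 * ε₀ ^ 2 + 9, by positivity, ?_⟩
  intro δ₀ hδ₀ hδ₀1
  set B : ℝ := Real.log (1 + Real.exp ε₀) with hB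
  have hB0 : 0 < B := Real.log_pos (by linarith [Real.exp_pos ε₀])
  have hL0 : 0 < Real.log (1 / δ₀) := Real.log_pos (by rwa [one_lt_div hδ₀])
  -- The message count is `18 + 2j ≤ 8L + 20 + 8B`; the constant part is absorbed using `L ≥ log
  -- (1/δ₀)`.
  refine ⟨8 + (20 + 8 * B) / Real.log (1 / δ₀), by positivity, ?_⟩
  intro ε hε hεε₀ δ hδ hδδ₀ n hn
  obtain ⟨k, rfl⟩ : ∃ k, n = k + 1 := ⟨n - 1, by omega⟩
  set L : ℝ := Real.log (1 / δ) with hL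
  have hLL : Real.log (1 / δ₀) ≤ L :=
    Real.log_le_log (by positivity) (one_div_le_one_div_of_le hδ hδδ₀)
  obtain ⟨b, hb1, hb2, hb3⟩ := ShuffleModel.exists_bits hn
  set j : ℕ := ⌈4 * (L + B)⌉₊
  have hj1 : (j : ℝ) ≤ 4 * (L + B) + 1 := (Nat.ceil_lt_add_one (by linarith)).le
  set α : ℝ := Real.exp (-(ε / ((k + 1 : ℕ) : ℝ))) with hαdef
  have hn0 : (0 : ℝ) < ((k + 1 : ℕ) : ℝ) := by positivity
  have hα : α ∈ Set.Ioo (0 : ℝ) 1 :=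
    ⟨Real.exp_pos _, Real.exp_lt_one_iff.2 (by rw [neg_lt_zero]; positivity)⟩
  have hr : ((k + 1 : ℕ) : NNReal) * ((k + 1 : ℕ) : NNReal)⁻¹ = 1 :=
    mul_inv_cancel₀ (by positivity)
  have hpow : α⁻¹ ^ (k + 1) = Real.exp ε := by
    rw [hαdef, ← Real.exp_neg, neg_neg, ← Real.exp_nat_mul, mul_div_cancel₀ _ hn0.ne']
  -- The smoothing error `γ` is chosen so that `(1 + exp ε) * γ ≤ δ`.
  have hγ : Real.exp (-(L + B)) = δ / (1 + Real.exp ε₀) := by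
    rw [neg_add, Real.exp_add, hL, one_div, Real.log_inv, neg_neg, Real.exp_log hδ, Real.exp_neg,
      hB, Real.exp_log (by positivity), div_eq_mul_inv]
  have e : (Fin b → Bool) ≃ ZMod (2 ^ b) := Fintype.equivOfCardEq (by simp [ZMod.card])
  refine ⟨2 * (8 + j) + 1 + 1, b, ShuffleModel.splitProtocol e
    (ShuffleModel.modNoise_nonneg hα (((k + 1 : ℕ) : NNReal)⁻¹))
    (ShuffleModel.sum_modNoise hα _) (k + 1) (2 * (8 + j) + 1), ?_, ?_, by omega, ?_, ?_⟩
  · refine ShuffleModel.isDP_splitProtocol e hα (Real.exp_pos (-(L + B))).le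
      (Real.exp_le_one_iff.2 (by linarith))
      (ShuffleModel.modulus_bound hn hb2 j (Nat.le_ceil _)) hpow hr ?_
    rw [hγ, mul_div_assoc', div_le_iff₀ (by positivity), mul_comm]
    gcongr
  · refine (ShuffleModel.mse_splitProtocol_le e hα hb1 hr).trans (ENNReal.ofReal_le_ofReal ?_)
    exact ShuffleModel.noise_scale_bound (by exact_mod_cast Nat.succ_le_succ (Nat.zero_le k)) hε hεε₀
  · have h1 : 20 + 8 * B ≤ (20 + 8 * B) / Real.log (1 / δ₀) * L := by
      rw [div_mul_eq_mul_div, le_div_iff₀ hL0]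
      exact mul_le_mul_of_nonneg_left hLL (by positivity)
    push_cast
    linarith
  · refine hb3.trans (mul_le_mul_of_nonneg_right ?_ (Real.log_natCast_nonneg _))
    nlinarith [sq_nonneg (1 + ε₀), sq_nonneg ε₀]
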